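/- **Setting.** Let $n,p\ge 1$ and $\mathcal J=\{(i,j):1\le i<j\le p\}$. For a parameter $\theta=(\beta_{1,0},\dots,\beta_{p,0},\beta_{1,1},\dots,\beta_{p,1})\in\mathbb R^{2p}$, the stationary two-way heterogeneity model (TWHM) $P_\theta$ is the law of a sequence of random symmetric adjacency matrices $X^t=(X^t_{i,j})\in\{0,1\}^{p\times p}$, $t\ge 0$, with zero diagonal, such that for $(i,j)\in\mathcal J$ and $t\ge1$ $$X^t_{i,j}=I(\varepsilon^t_{i,j}=0)+X^{t-1}_{i,j}\,I(\varepsilon^t_{i,j}=1),$$ where, with $Z_{i,j}(\theta)=1+e^{\beta_{i,0}+\beta_{j,0}}+e^{\beta_{i,1}+\beta_{j,1}}$, $$P(\varepsilon^t_{i,j}=r)=\frac{e^{\beta_{i,r}+\beta_{j,r}}}{Z_{i,j}(\theta)}\ (r=0,1),\qquad P(\varepsilon^t_{i,j}=-1)=\frac1{Z_{i,j}(\theta)},\qquad P(X^0_{i,j}=1)=\frac{e^{\beta_{i,0}+\beta_{j,0}}}{1+e^{\beta_{i,0}+\beta_{j,0}}},$$ and all the variables $X^0_{i,j}$ and $\varepsilon^t_{i,j}$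 ($(i,j)\in\mathcal J$, $t\ge1$) are independent. The loss is the normalized negative log-likelihood of $X^1,\dots,X^n$ given $X^0$, $$l(\theta)=\frac1p\sum_{i<j}\log Z_{i,j}(\theta)-\frac1{np}\sum_{i<j}\Big\{(\beta_{i,0}+\beta_{j,0})\sum_{t=1}^nX^t_{i,j}+\log\big(1+e^{\beta_{i,1}+\beta_{j,1}}\big)\sum_{t=1}^n(1-X^t_{i,j})(1-X^{t-1}_{i,j})+\log\big(1+e^{\beta_{i,1}+\beta_{j,1}-\beta_{i,0}-\beta_{j,0}}\big)\sum_{t=1}^nX^t_{i,j}X^{t-1}_{i,j}\Big\}.$$ For a node $i$ write $\theta_{(i)}=(\beta_{i,0},\beta_{i,1})$, let $\theta_{(-i)}$ be the remaining coordinates, and write $l(\theta)=l(\theta_{(i)},\theta_{(-i)})$. Let $\mathbf B_\infty(x,r)=\{y:\|y-x\|_\infty\le r\}$. **Statement.** Let $0<\alpha_0<1/4$ and let $K$ be a constant. For every $c_1>0$ and every $c_2>0$ there are constants $C_1>0$, depending only on $\alpha_0,K,c_1$, and $C_2>0$, depending only on $\alpha_0,K,c_2$, such that for all $n,p\ge1$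 and every true parameter $\theta^*=(\beta^*_{i,r})$ with $\beta^*_{i,1}-\max(\beta^*_{i,0},0)<K$ for $i=1,\dots,p$, if $\{X^t\}\sim P_{\theta^*}$ (the expectation $\mathbb E$ being under this law), then: (i) with probability greater than $1-(np)^{-c_1}$, simultaneously for all $\theta\in\mathbf B_\infty(\theta^*,\alpha_0)$, $$\Big|\big(l(\theta)-l(\theta^*)\big)-\big(\mathbb E\,l(\theta)-\mathbb E\,l(\theta^*)\big)\Big|\le C_1\Big(1+\frac{\log(np)}{\sqrt p}\Big)\sqrt{\frac{\log(np)}{n}}\;\|\theta-\theta^*\|_2;$$ (ii) with probability greater than $1-(np)^{-c_2}$, simultaneously for all $i=1,\dots,p$ and all $\theta_{(i)}\in\mathbf B_\infty(\theta^*_{(i)},\alpha_0)$, $$\Big|l(\theta_{(i)},\theta^*_{(-i)})-l(\theta^*_{(i)},\theta^*_{(-i)})-\big[\mathbb E\,l(\theta_{(i)},\theta^*_{(-i)})-\mathbb E\,l(\theta^*_{(i)},\theta^*_{(-i)})\big]\Big|\le C_2\Big(1+\frac{\log(np)}{\sqrt p}\Big)\sqrt{\frac{\log(np)}{n}}\;\|\theta_{(i)}-\theta^*_{(i)}\|_2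 .$$ -/

import Mathlib

open MeasureTheory ProbabilityTheory

noncomputable section

namespace TWHM

/-- The index set of unordered pairs of distinct nodes, written as ordered pairs `i < j`. -/
abbrev Edge (p : ℕ) : Type := {e : Fin p × Fin p // e.1 < e.2}

/-- Parameter vectors `θ ∈ ℝ^{2p}`, with the Euclidean norm: `θ (i, 0)` is the static parameter
`β_{i,0}` of node `i` and `θ (i, 1)` is its dynamic parameter `β_{i,1}`. -/
abbrev Param (p : ℕ) : Type := EuclideanSpace ℝ (Fin p × Fin 2)

/-- The closed ball of radius `r` around `x` for the sup norm. -/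
def linftyBall {ι : Type*} [Fintype ι] (x : EuclideanSpace ℝ ι) (r : ℝ) :
    Set (EuclideanSpace ℝ ι) :=
  {y | ‖WithLp.ofLp y - WithLp.ofLp x‖ ≤ r}

/-- `β_{i,r} + β_{j,r}` for the pair `e = (i, j)`. -/
def pairSum {p : ℕ} (θ : Param p) (r : Fin 2) (e : Edge p) : ℝ :=
  θ (e.1.1, r) + θ (e.1.2, r)

/-- The normalizing constant `1 + exp (β_{i,0} + β_{j,0}) + exp (β_{i,1} + β_{j,1})`. -/
def partitionFn {p : ℕ} (θ : Param p) (e : Edge p) : ℝ :=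
  1 + Real.exp (pairSum θ 0 e) + Real.exp (pairSum θ 1 e)

/-- The adjacency matrices `X 0, X 1, X 2, …` of an undirected network without self-loops follow
the stationary two-way heterogeneity model with parameter `θ`, driven by the innovations
`ε t e`, `t ≥ 1` (`ε 0` plays no role). -/
structure IsDrivenBy {p : ℕ} {Ω : Type*} [MeasurableSpace Ω] (μ : Measure Ω) (θ : Param p)
    (X : ℕ → Ω → Matrix (Fin p) (Fin p) ℤ) (ε : ℕ → Edge p → Ω → ℤ) : Prop where
  zero_or_one : ∀ t ω i j, X t ω i j = 0 ∨ X t ω i j = 1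
  symm : ∀ t ω i j, X t ω i j = X t ω j i
  no_loop : ∀ t ω i, X t ω i i = 0
  measurable_init : ∀ e : Edge p, Measurable fun ω => X 0 ω e.1.1 e.1.2
  measurable_innov : ∀ (t : ℕ) (e : Edge p), 1 ≤ t → Measurable (ε t e)
  /-- `X^t_{i,j} = I(ε^t_{i,j} = 0) + X^{t-1}_{i,j} I(ε^t_{i,j} = 1)`. -/
  recursion : ∀ (t : ℕ) (e : Edge p) (ω : Ω),
    X (t + 1) ω e.1.1 e.1.2 =
      (if ε (t + 1) e ω = 0 then 1 else 0)
        + X t ω e.1.1 e.1.2 * (if ε (t + 1) e ω = 1 then 1 else 0)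
  prob_innov_zero : ∀ (t : ℕ) (e : Edge p), 1 ≤ t →
    μ.real {ω | ε t e ω = 0} = Real.exp (pairSum θ 0 e) / partitionFn θ e
  prob_innov_one : ∀ (t : ℕ) (e : Edge p), 1 ≤ t →
    μ.real {ω | ε t e ω = 1} = Real.exp (pairSum θ 1 e) / partitionFn θ e
  prob_innov_neg_one : ∀ (t : ℕ) (e : Edge p), 1 ≤ t →
    μ.real {ω | ε t e ω = -1} = 1 / partitionFn θ e
  /-- The initial network has the stationary marginal distribution. -/
  prob_init : ∀ e : Edge p,
    μ.real {ω | X 0 ω e.1.1 e.1.2 = 1}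
      = Real.exp (pairSum θ 0 e) / (1 + Real.exp (pairSum θ 0 e))
  /-- The initial edges and all the innovations are jointly independent. -/
  indep : iIndepFun
    (fun (k : Edge p × ℕ) (ω : Ω) => if k.2 = 0 then X 0 ω k.1.1.1 k.1.1.2 else ε k.2 k.1 ω) μ

/-- `{X^t} ∼ P_θ`: the process follows the stationary two-way heterogeneity model. -/
def IsTWHM {p : ℕ} {Ω : Type*} [MeasurableSpace Ω] (μ : Measure Ω) (θ : Param p)
    (X : ℕ → Ω → Matrix (Fin p) (Fin p) ℤ) : Prop :=
  ∃ ε : ℕ → Edge p → Ω → ℤ, IsDrivenBy μ θ X ε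

/-- `a_{i,j} = ∑_{t=1}^n X^t_{i,j}`. -/
def statA {p : ℕ} (n : ℕ) (x : ℕ → Matrix (Fin p) (Fin p) ℤ) (e : Edge p) : ℝ :=
  ∑ t ∈ Finset.Icc 1 n, (x t e.1.1 e.1.2 : ℝ)

/-- `b_{i,j} = ∑_{t=1}^n X^t_{i,j} X^{t-1}_{i,j}`. -/
def statB {p : ℕ} (n : ℕ) (x : ℕ → Matrix (Fin p) (Fin p) ℤ) (e : Edge p) : ℝ :=
  ∑ t ∈ Finset.Icc 1 n, (x t e.1.1 e.1.2 : ℝ) * (x (t - 1) e.1.1 e.1.2 : ℝ)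

/-- `d_{i,j} = ∑_{t=1}^n (1 - X^t_{i,j}) (1 - X^{t-1}_{i,j})`. -/
def statD {p : ℕ} (n : ℕ) (x : ℕ → Matrix (Fin p) (Fin p) ℤ) (e : Edge p) : ℝ :=
  ∑ t ∈ Finset.Icc 1 n, (1 - (x t e.1.1 e.1.2 : ℝ)) * (1 - (x (t - 1) e.1.1 e.1.2 : ℝ))

/-- The loss `l(θ)` of an observed trajectory `x 0, …, x n`: the negative log-likelihood
conditionally on `x 0`, divided by `n p`. -/
def loss {p : ℕ} (n : ℕ) (x : ℕ → Matrix (Fin p) (Fin p) ℤ) (θ : Param p) : ℝ :=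
  1 / (p : ℝ) * ∑ e : Edge p, Real.log (partitionFn θ e)
    - 1 / ((n : ℝ) * p) * ∑ e : Edge p,
        (pairSum θ 0 e * statA n x e
          + Real.log (1 + Real.exp (pairSum θ 1 e)) * statD n x e
          + Real.log (1 + Real.exp (pairSum θ 1 e - pairSum θ 0 e)) * statB n x e)

/-- The random loss `l(θ)` of the process `X` observed at times `0, …, n`. -/
def randLoss {p : ℕ} {Ω : Type*} (n : ℕ) (X : ℕ → Ω → Matrix (Fin p) (Fin p) ℤ) (θ : Param p)
    (ω : Ω) : ℝ :=
  loss n (fun t => X t ω) θ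

/-- The expected loss `E l(θ)`. -/
def expLoss {p : ℕ} {Ω : Type*} [MeasurableSpace Ω] (μ : Measure Ω) (n : ℕ)
    (X : ℕ → Ω → Matrix (Fin p) (Fin p) ℤ) (θ : Param p) : ℝ :=
  ∫ ω, randLoss n X θ ω ∂μ

/-- The parameters `θ_(i) = (β_{i,0}, β_{i,1})` of node `i`. -/
def nodeParam {p : ℕ} (θ : Param p) (i : Fin p) : EuclideanSpace ℝ (Fin 2) :=
  WithLp.toLp 2 fun r => θ (i, r)

/-- The parameter `(η, θ_(-i))`: node `i` has parameters `η`, all other nodes keep those of `θ`. -/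
def withNode {p : ℕ} (θ : Param p) (i : Fin p) (η : EuclideanSpace ℝ (Fin 2)) : Param p :=
  WithLp.toLp 2 fun k => if k.1 = i then η k.2 else θ k

/-- The rate `(1 + log(np)/√p) √(log(np)/n)`. -/
def rate (n p : ℕ) : ℝ :=
  (1 + Real.log ((n : ℝ) * p) / Real.sqrt p) * Real.sqrt (Real.log ((n : ℝ) * p) / n)

end TWHM

end

noncomputable section

namespace TWHM

open scoped NNReal

/-! ### Sub-Gaussian tools. -/

section SubGaussian

variable {Ω : Type*} [mΩ : MeasurableSpace Ω] {μ : Measure Ω}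

/-! After centering, the normalizing constants cancel and the loss is linear in the centered
statistics `devA`, `devB`, `devD` (`IsDrivenBy.randLoss_sub_expLoss`). By the mean value theorem its
increment from `θs` to `θ` is a directional derivative, `totalScore`, at a random intermediate
point. So it suffices to bound the score uniformly over nearby points and unit directions.

For one edge and a fixed point and direction, the score is an additive functional of a two-state
Markov chain. Solving the Poisson equation writes it, after centering, as a martingale plus a
boundary term. The delicate point is that the solution is bounded uniformly in the true parameters,
even when the chain is so persistent that it mixes slowly (`exists_poisson_solution`): a large part
of the numerator cancels when the score is evaluated near the truth. Hence the edge score is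
sub-Gaussian with variance proxy of order `n`. Edges are independent and each node meets fewer than
`p` of them, so for a unit direction the total score has proxy of order `n p`
(`IsDrivenBy.measure_totalScore_ge_le`).

A union bound over pairs of grid points of mesh of order `1 / (n p)`, at most `(n p) ^ (12 p)` of
them, costs `p log (n p)` in the exponent, giving a level of order `n p √(log (n p) / n)`. A crude
Lipschitz bound turns rounding into an error of order `p`. Division by `n p` leaves a rate `√(log (n
p) / n)`, which `rate` dominates. The nodewise bound is the restriction of the global one to
parameters that differ from `θs` at a single node. -/

theorem HasSubgaussianMGF.mono {Y : Ω → ℝ} {c c' : ℝ≥0} (h : HasSubgaussianMGF Y c μ)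
    (hc : c ≤ c') : HasSubgaussianMGF Y c' μ where
  integrable_exp_mul := h.integrable_exp_mul
  mgf_le t := (h.mgf_le t).trans <| by gcongr

theorem HasSubgaussianMGF.const_mul_of_abs_le {Y : Ω → ℝ} {C : ℝ≥0} (h : HasSubgaussianMGF Y C μ)
    {r : ℝ} {c : ℝ≥0} (hr : |r| ≤ c) : HasSubgaussianMGF (fun ω => r * Y ω) (c ^ 2 * C) μ := by
  have hr' : r ^ 2 ≤ (c : ℝ) ^ 2 := sq_le_sq' (by linarith [(abs_le.1 hr).1]) (abs_le.1 hr).2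
  exact HasSubgaussianMGF.mono (h.const_mul r)
    (mul_le_mul_of_nonneg_right (show (⟨r ^ 2, sq_nonneg r⟩ : ℝ≥0) ≤ c ^ 2 from hr') zero_le)

/-- A random variable with sub-Gaussian moment generating function is centered. -/
theorem HasSubgaussianMGF.integral_eq_zero [IsProbabilityMeasure μ] {Y : Ω → ℝ} {c : ℝ≥0}
    (h : HasSubgaussianMGF Y c μ) : ∫ ω, Y ω ∂μ = 0 := by
  set m := ∫ ω, Y ω ∂μ
  have hint : Integrable Y μ := h.integrable
  have key (t : ℝ) : 0 ≤ Real.exp (c * t ^ 2 / 2) - 1 - t * m := by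
    have h1 : ∫ ω, (t * Y ω + 1) ∂μ ≤ ∫ ω, Real.exp (t * Y ω) ∂μ :=
      integral_mono ((hint.const_mul t).add (integrable_const 1)) (h.integrable_exp_mul t)
        fun ω => Real.add_one_le_exp _
    rw [integral_add (hint.const_mul t) (integrable_const 1), integral_const_mul] at h1
    have h2 := h.mgf_le t
    simp only [mgf] at h2
    simp only [integral_const, probReal_univ, smul_eq_mul, mul_one] at h1
    linarith
  -- The function is nonnegative and vanishes at `0`, so its derivative `-m` there must vanish.
  have hmin : IsLocalMin (fun t : ℝ => Real.exp (c * t ^ 2 / 2) - 1 - t * m) 0 :=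
    Filter.Eventually.of_forall fun t => by simpa using key t
  have hder : HasDerivAt (fun t : ℝ => Real.exp (c * t ^ 2 / 2) - 1 - t * m) (-m) 0 := by
    have h1 : HasDerivAt (fun t : ℝ => (c : ℝ) * t ^ 2 / 2) 0 0 := by
      simpa using ((hasDerivAt_pow 2 (0 : ℝ)).const_mul (c : ℝ)).div_const 2
    exact ((h1.exp.sub_const 1).sub ((hasDerivAt_id (0 : ℝ)).mul_const m)).congr_deriv (by simp)
  linarith [hmin.hasDerivAt_eq_zero hder]

/-- If `Y` and the `{0, 1}`-valued state `x` are determined by a σ-algebra independent of `ε`, and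
`g a ε` is sub-Gaussian for each of the two states `a`, then `Y + g x ε` is sub-Gaussian. -/
theorem HasSubgaussianMGF.add_of_indep_state [IsProbabilityMeasure μ] {m : MeasurableSpace Ω}
    (hm : m ≤ mΩ) {Y : Ω → ℝ} {x ε : Ω → ℤ} {g : ℤ → ℤ → ℝ} {C c : ℝ≥0}
    (hY : HasSubgaussianMGF Y C μ) (hYm : Measurable[m] Y) (hxm : Measurable[m] x)
    (hx : ∀ ω, x ω = 0 ∨ x ω = 1)
    (hind : Indep m (MeasurableSpace.comap ε inferInstance) μ)
    (hg0 : HasSubgaussianMGF (fun ω => g 0 (ε ω)) c μ)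
    (hg1 : HasSubgaussianMGF (fun ω => g 1 (ε ω)) c μ) :
    HasSubgaussianMGF (fun ω => Y ω + g (x ω) (ε ω)) (C + c) μ := by
  have hI (a : ℤ) (t : ℝ) : Measurable[m]
      fun ω => Real.exp (t * Y ω) * Set.indicator (x ⁻¹' {a}) (fun _ => (1 : ℝ)) ω :=
    (Real.measurable_exp.comp (hYm.const_mul t)).mul
      (measurable_const.indicator (hxm (measurableSet_singleton a)))
  have hindep (a : ℤ) (t : ℝ) : IndepFun
      (fun ω => Real.exp (t * Y ω) * Set.indicator (x ⁻¹' {a}) (fun _ => (1 : ℝ)) ω)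
      (fun ω => Real.exp (t * g a (ε ω))) μ := by
    rw [IndepFun_iff_Indep]
    refine indep_of_indep_of_le_left (indep_of_indep_of_le_right hind ?_) (hI a t).comap_le
    have : Measurable[MeasurableSpace.comap ε inferInstance]
        fun ω => Real.exp (t * g a (ε ω)) :=
      (measurable_of_countable fun b : ℤ => Real.exp (t * g a b)).comp
        (comap_measurable ε)
    exact this.comap_le
  have hint1 (a : ℤ) (t : ℝ) : Integrable
      (fun ω => Real.exp (t * Y ω) * Set.indicator (x ⁻¹' {a}) (fun _ => (1 : ℝ)) ω) μ := by
    refine (hY.integrable_exp_mul t).mono (((hI a t).mono hm le_rfl).aestronglyMeasurable) ?_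
    refine Filter.Eventually.of_forall fun ω => ?_
    rw [norm_mul]
    refine mul_le_of_le_one_right (norm_nonneg _) ?_
    by_cases hω : ω ∈ x ⁻¹' {a} <;> simp [Set.indicator, hω]
  have hg (a : ℤ) (ha : a = 0 ∨ a = 1) : HasSubgaussianMGF (fun ω => g a (ε ω)) c μ := by
    rcases ha with rfl | rfl <;> assumption
  have hint (a : ℤ) (ha : a = 0 ∨ a = 1) (t : ℝ) := (hindep a t).integrable_mul (hint1 a t)
    ((hg a ha).integrable_exp_mul t)
  -- Splitting over the two states replaces conditioning on `m`: on `x = a` the exponential is an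
  -- `m`-measurable factor times a function of `ε` alone.
  have hsplit (t : ℝ) : (fun ω => Real.exp (t * (Y ω + g (x ω) (ε ω)))) =
      ((fun ω => Real.exp (t * Y ω) * Set.indicator (x ⁻¹' {0}) (fun _ => (1 : ℝ)) ω) *
        fun ω => Real.exp (t * g 0 (ε ω))) +
      ((fun ω => Real.exp (t * Y ω) * Set.indicator (x ⁻¹' {1}) (fun _ => (1 : ℝ)) ω) *
        fun ω => Real.exp (t * g 1 (ε ω))) := by
    funext ω
    rcases hx ω with h | h <;> simp [h, Set.indicator, mul_add, Real.exp_add]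
  refine ⟨fun t => ?_, fun t => ?_⟩
  · rw [hsplit]
    exact (hint 0 (Or.inl rfl) t).add (hint 1 (Or.inr rfl) t)
  · have hbound (a : ℤ) (ha : a = 0 ∨ a = 1) :
        ∫ ω, ((fun ω => Real.exp (t * Y ω) * Set.indicator (x ⁻¹' {a}) (fun _ => (1 : ℝ)) ω) *
          fun ω => Real.exp (t * g a (ε ω))) ω ∂μ ≤
        (∫ ω, Real.exp (t * Y ω) * Set.indicator (x ⁻¹' {a}) (fun _ => (1 : ℝ)) ω ∂μ) *
          Real.exp (c * t ^ 2 / 2) := by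
      rw [(hindep a t).integral_mul_eq_mul_integral (hint1 a t).1
        ((hg a ha).integrable_exp_mul t).1]
      refine mul_le_mul_of_nonneg_left ((hg a ha).mgf_le t) (integral_nonneg fun ω => ?_)
      exact mul_nonneg (Real.exp_nonneg _) (Set.indicator_nonneg (fun _ _ => zero_le_one) _)
    have hY' : (∫ ω, Real.exp (t * Y ω) * Set.indicator (x ⁻¹' {0}) (fun _ => (1 : ℝ)) ω ∂μ) +
        ∫ ω, Real.exp (t * Y ω) * Set.indicator (x ⁻¹' {1}) (fun _ => (1 : ℝ)) ω ∂μ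
        = mgf Y μ t := by
      rw [← integral_add (hint1 0 t) (hint1 1 t)]
      refine integral_congr_ae (Filter.Eventually.of_forall fun ω => ?_)
      rcases hx ω with h | h <;> simp [h, Set.indicator]
    calc mgf (fun ω => Y ω + g (x ω) (ε ω)) μ t
        = _ + _ := by
          rw [mgf, hsplit]
          exact integral_add (hint 0 (Or.inl rfl) t) (hint 1 (Or.inr rfl) t)
      _ ≤ _ + _ := add_le_add (hbound 0 (Or.inl rfl)) (hbound 1 (Or.inr rfl))
      _ = mgf Y μ t * Real.exp (c * t ^ 2 / 2) := by rw [← add_mul, hY']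
      _ ≤ Real.exp (C * t ^ 2 / 2) * Real.exp (c * t ^ 2 / 2) := by
          gcongr
          exact hY.mgf_le t
      _ = Real.exp ((C + c : ℝ≥0) * t ^ 2 / 2) := by
          rw [← Real.exp_add]
          push_cast
          ring_nf

end SubGaussian

/-! ### Additive functionals of a two-state chain. -/

section Chain

variable {Ω : Type*} [mΩ : MeasurableSpace Ω] {μ : Measure Ω}

/-- `x 0, x 1, …` is a `{0, 1}`-valued chain adapted to `𝓕`, driven by innovations `ε (t + 1)`
independent of `𝓕 t` which equal `0` with probability `P₀` and `1` with probability `P₁`. -/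
structure IsTwoStateChain (μ : Measure Ω) (𝓕 : ℕ → MeasurableSpace Ω) (x ε : ℕ → Ω → ℤ)
    (P₀ P₁ : ℝ) : Prop where
  le : ∀ t, 𝓕 t ≤ mΩ
  mono : Monotone 𝓕
  adapted : ∀ t, Measurable[𝓕 t] (x t)
  zero_or_one : ∀ t ω, x t ω = 0 ∨ x t ω = 1
  measurable_innov : ∀ t, Measurable (ε (t + 1))
  indep : ∀ t, Indep (𝓕 t) (MeasurableSpace.comap (ε (t + 1)) inferInstance) μ
  recursion : ∀ t ω, x (t + 1) ω =
    (if ε (t + 1) ω = 0 then 1 else 0) + x t ω * (if ε (t + 1) ω = 1 then 1 else 0)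
  prob_zero : ∀ t, μ.real {ω | ε (t + 1) ω = 0} = P₀
  prob_one : ∀ t, μ.real {ω | ε (t + 1) ω = 1} = P₁

namespace IsTwoStateChain

variable {𝓕 : ℕ → MeasurableSpace Ω} {x ε : ℕ → Ω → ℤ} {P₀ P₁ : ℝ}

theorem measurable (h : IsTwoStateChain μ 𝓕 x ε P₀ P₁) (t : ℕ) :
    Measurable fun ω => (x t ω : ℝ) :=
  (measurable_of_countable _).comp ((h.adapted t).mono (h.le t) le_rfl)

theorem cast_zero_or_one (h : IsTwoStateChain μ 𝓕 x ε P₀ P₁) (t : ℕ) (ω : Ω) :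
    (x t ω : ℝ) = 0 ∨ (x t ω : ℝ) = 1 := by
  rcases h.zero_or_one t ω with h | h <;> simp [h]

theorem mem_Icc (h : IsTwoStateChain μ 𝓕 x ε P₀ P₁) (t : ℕ) (ω : Ω) :
    (x t ω : ℝ) ∈ Set.Icc (0 : ℝ) 1 := by
  rcases h.cast_zero_or_one t ω with h | h <;> simp [h]

theorem integrable [IsProbabilityMeasure μ] (h : IsTwoStateChain μ 𝓕 x ε P₀ P₁) (t : ℕ) :
    Integrable (fun ω => (x t ω : ℝ)) μ :=
  Integrable.of_mem_Icc 0 1 (h.measurable t).aemeasurable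
    (Filter.Eventually.of_forall (h.mem_Icc t))

theorem subgaussian_innov [IsProbabilityMeasure μ] (h : IsTwoStateChain μ 𝓕 x ε P₀ P₁) (t : ℕ)
    (a : ℤ) (ha : a = 0 ∨ a = 1) (κ : ℝ) (c : ℝ≥0) (hκ : |κ| ≤ c) :
    HasSubgaussianMGF (fun ω => κ * (((if ε (t + 1) ω = 0 then 1 else 0) +
      a * (if ε (t + 1) ω = 1 then 1 else 0) : ℝ) - (P₀ + P₁ * a))) (c ^ 2) μ := by
  have hind (b : ℤ) : (fun ω => if ε (t + 1) ω = b then (1 : ℝ) else 0) =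
      Set.indicator {ω | ε (t + 1) ω = b} 1 := by
    funext ω
    simp [Set.indicator]
  have hms (b : ℤ) : MeasurableSet {ω | ε (t + 1) ω = b} :=
    h.measurable_innov t (measurableSet_singleton b)
  have hmeas (b : ℤ) : Measurable (fun ω => if ε (t + 1) ω = b then (1 : ℝ) else 0) := by
    rw [hind]
    exact measurable_const.indicator (hms b)
  have hint (b : ℤ) : ∫ ω, (if ε (t + 1) ω = b then (1 : ℝ) else 0) ∂μ =
      μ.real {ω | ε (t + 1) ω = b} := by
    rw [hind, integral_indicator_one (hms b)]
  have hi (b : ℤ) : Integrable (fun ω => if ε (t + 1) ω = b then (1 : ℝ) else 0) μ := by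
    rw [hind]
    exact (integrable_const 1).indicator (hms b)
  have hE : μ[fun ω => ((if ε (t + 1) ω = 0 then 1 else 0) +
      a * (if ε (t + 1) ω = 1 then 1 else 0) : ℝ)] = P₀ + P₁ * a := by
    rw [integral_add (hi 0) ((hi 1).const_mul _), integral_const_mul, hint, hint, h.prob_zero,
      h.prob_one, mul_comm]
  have hsub := hasSubgaussianMGF_of_mem_Icc (μ := μ) (a := 0) (b := 1)
    (((hmeas 0).add ((hmeas 1).const_mul (a : ℝ))).aemeasurable)
    (Filter.Eventually.of_forall fun ω => by
      rcases ha with rfl | rfl <;> simp <;> split_ifs <;> simp_all)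
  simp only [Pi.add_apply] at hsub
  rw [hE] at hsub
  refine HasSubgaussianMGF.mono (HasSubgaussianMGF.const_mul_of_abs_le hsub hκ) ?_
  -- Hoeffding's lemma on `[0, 1]` gives the factor `(1 / 2) ^ 2`, rounded up to `1`.
  refine mul_le_of_le_one_right' (pow_le_one₀ zero_le ?_)
  rw [sub_zero, nnnorm_one]
  exact NNReal.half_le_self 1

/-- The martingale `∑ κ(x_t) (x_{t+1} - E[x_{t+1} | x_t])` is sub-Gaussian. -/
theorem subgaussian_martingale [IsProbabilityMeasure μ] (h : IsTwoStateChain μ 𝓕 x ε P₀ P₁)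
    (κ₀ κ₁ : ℝ) (c : ℝ≥0) (hκ₀ : |κ₀| ≤ c) (hκ₁ : |κ₀ + κ₁| ≤ c) (n : ℕ) :
    HasSubgaussianMGF (fun ω => ∑ t ∈ Finset.range n,
      (κ₀ + κ₁ * x t ω) * (x (t + 1) ω - (P₀ + P₁ * x t ω))) (n * c ^ 2) μ := by
  induction n with
  | zero => simp
  | succ n ih =>
    have hadd := HasSubgaussianMGF.add_of_indep_state (h.le n) (x := x n) (ε := ε (n + 1))
      (g := fun a b => (κ₀ + κ₁ * a) * (((if b = 0 then 1 else 0) +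
        a * (if b = 1 then 1 else 0) : ℝ) - (P₀ + P₁ * a))) (c := c ^ 2) ih ?_
      (h.adapted n) (h.zero_or_one n) (h.indep n)
      (h.subgaussian_innov n 0 (Or.inl rfl) _ c (by simpa using hκ₀))
      (h.subgaussian_innov n 1 (Or.inr rfl) _ c (by simpa using hκ₁))
    · have hc : ((n + 1 : ℕ) : ℝ≥0) * c ^ 2 = n * c ^ 2 + c ^ 2 := by push_cast; ring
      rw [hc]
      refine hadd.congr (Filter.Eventually.of_forall fun ω => ?_)
      simp only [Finset.sum_range_succ, h.recursion n ω]
      push_cast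
      rfl
    · refine Finset.measurable_sum _ fun t ht => ?_
      rw [Finset.mem_range] at ht
      have h1 (s : ℕ) (hs : s ≤ n) : Measurable[𝓕 n] fun ω => (x s ω : ℝ) :=
        (measurable_of_countable fun z : ℤ => (z : ℝ)).comp
          ((h.adapted s).mono (h.mono hs) le_rfl)
      exact (measurable_const.add ((h1 t ht.le).const_mul κ₁)).mul
        ((h1 (t + 1) ht).sub (measurable_const.add ((h1 t ht.le).const_mul P₁)))

/-- An additive functional of the chain is sub-Gaussian after centering. The number `b` solves the
Poisson equation of the functional, and `c` bounds it and the resulting martingale increments. -/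
theorem subgaussian_additive [IsProbabilityMeasure μ] (h : IsTwoStateChain μ 𝓕 x ε P₀ P₁)
    (cA cB cD b : ℝ) (c : ℝ≥0)
    (hb : b * (1 - P₁) = (P₀ + P₁) * (cA + cB) - P₀ * cA - (1 - P₀) * cD)
    (hbc : |b| ≤ c) (hκ₀ : |cA - cD + b| ≤ c) (hκ₁ : |cA + cB + b| ≤ c) {n : ℕ} (hn : 1 ≤ n)
    {W : Ω → ℝ} (hW : ∀ ω, W ω = ∑ t ∈ Finset.range n, (cA * x (t + 1) ω
      + cB * (x (t + 1) ω * x t ω) + cD * ((1 - x (t + 1) ω) * (1 - x t ω)))) :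
    HasSubgaussianMGF (fun ω => W ω - ∫ ω', W ω' ∂μ) (4 * n * c ^ 2) μ := by
  set M : Ω → ℝ := fun ω => ∑ t ∈ Finset.range n,
      ((cA - cD + b) + (cB + cD) * x t ω) * (x (t + 1) ω - (P₀ + P₁ * x t ω)) with hMdef
  have hM : HasSubgaussianMGF M (n * c ^ 2) μ :=
    h.subgaussian_martingale _ _ c hκ₀ (by convert hκ₁ using 2; ring) n
  set D : Ω → ℝ := fun ω => (x 0 ω : ℝ) - x n ω
  have hDint : Integrable D μ := (h.integrable 0).sub (h.integrable n)
  have hD : HasSubgaussianMGF (fun ω => b * (D ω - μ[D])) (c ^ 2) μ := by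
    have h1 := hasSubgaussianMGF_of_mem_Icc (μ := μ) (X := D) (a := -1) (b := 1)
      ((h.measurable 0).sub (h.measurable n)).aemeasurable
      (Filter.Eventually.of_forall fun ω => by
        have h0 := h.mem_Icc 0 ω
        have h1 := h.mem_Icc n ω
        simp only [Set.mem_Icc, D] at h0 h1 ⊢
        constructor <;> linarith)
    refine HasSubgaussianMGF.mono (HasSubgaussianMGF.const_mul_of_abs_le h1 hbc) (le_of_eq ?_)
    norm_num
  -- Martingale decomposition with Poisson solution `b * x`, whose increments telescope to `b * D`.
  -- The stepwise identity holds for any `b` when `x t = 0`; when `x t = 1` it is exactly `hb`.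
  have hWM (ω : Ω) : W ω = M ω + b * D ω + n * (cD + P₀ * (cA - cD + b)) := by
    have hstep (t : ℕ) : cA * x (t + 1) ω + cB * (x (t + 1) ω * x t ω)
        + cD * ((1 - x (t + 1) ω) * (1 - x t ω)) =
        ((cA - cD + b) + (cB + cD) * x t ω) * (x (t + 1) ω - (P₀ + P₁ * x t ω))
          + b * ((x t ω : ℝ) - x (t + 1) ω) + (cD + P₀ * (cA - cD + b)) := by
      rcases h.cast_zero_or_one t ω with h0 | h0 <;>
        rcases h.cast_zero_or_one (t + 1) ω with h1 | h1 <;> rw [h0, h1] <;> linarith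
    rw [hW, Finset.sum_congr rfl fun t _ => hstep t, Finset.sum_add_distrib,
      Finset.sum_add_distrib, ← Finset.mul_sum, Finset.sum_range_sub']
    simp [M, D, mul_add]
  have hWint : ∫ ω, W ω ∂μ = b * μ[D] + n * (cD + P₀ * (cA - cD + b)) := by
    simp_rw [hWM]
    rw [integral_add (f := fun ω => M ω + b * D ω) (hM.integrable.add (hDint.const_mul b))
        (integrable_const _),
      integral_add hM.integrable (hDint.const_mul b), HasSubgaussianMGF.integral_eq_zero hM,
      integral_const_mul]
    simp
  refine HasSubgaussianMGF.mono ((hM.add hD).congr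
    (Filter.Eventually.of_forall fun ω => ?_)) ?_
  · simp only [hWint, hWM ω]
    ring
  -- `M` and `D` are dependent, so the square roots of their proxies add up; `1 ≤ n` lets the
  -- martingale's proxy dominate, whence the factor `4`.
  · have hn' : (1 : ℝ≥0) ≤ n := by exact_mod_cast hn
    have hs : NNReal.sqrt (c ^ 2) ≤ NNReal.sqrt (n * c ^ 2) := by
      gcongr
      exact le_mul_of_one_le_left' hn'
    calc (NNReal.sqrt (n * c ^ 2) + NNReal.sqrt (c ^ 2)) ^ 2
        ≤ (NNReal.sqrt (n * c ^ 2) + NNReal.sqrt (n * c ^ 2)) ^ 2 := by gcongr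
      _ = 4 * n * c ^ 2 := by rw [← two_mul, mul_pow, NNReal.sq_sqrt]; ring

end IsTwoStateChain

end Chain

/-! ### The score of one edge and its Poisson equation. -/

/-- The directional derivative in the direction `(v₀, v₁)`, at the point `(s₀, s₁)`, of
`s₀ a + log (1 + exp s₁) d + log (1 + exp (s₁ - s₀)) b`. -/
def edgeScore (s₀ s₁ v₀ v₁ a b d : ℝ) : ℝ :=
  v₀ * (a - Real.sigmoid (s₁ - s₀) * b) + v₁ * (Real.sigmoid s₁ * d + Real.sigmoid (s₁ - s₀) * b)

/-- Since `√e < 2`. The radius `1 / 2` is what a sum of two coordinates can move when each moves by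
at most `1 / 4`. -/
theorem exp_le_two_mul_exp {x y : ℝ} (h : |x - y| ≤ 1 / 2) : Real.exp x ≤ 2 * Real.exp y := by
  have h1 : Real.exp (1 / 2) ≤ 2 := by
    have h2 : Real.exp (1 / 2) ^ 2 = Real.exp 1 := by rw [← Real.exp_nat_mul]; norm_num
    nlinarith [Real.exp_one_lt_d9, Real.exp_pos (1 / 2)]
  calc Real.exp x ≤ Real.exp (1 / 2 + y) := Real.exp_le_exp.2 (by linarith [(abs_le.1 h).2])
    _ = Real.exp (1 / 2) * Real.exp y := Real.exp_add _ _
    _ ≤ 2 * Real.exp y := by gcongr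

theorem sigmoid_sub_eq (x y : ℝ) :
    Real.sigmoid (x - y) = Real.exp x / (Real.exp y + Real.exp x) := by
  have hx := Real.exp_pos x
  have hy := Real.exp_pos y
  rw [Real.sigmoid_def, neg_sub, Real.exp_sub]
  field_simp
  ring

theorem sigmoid_eq (x : ℝ) : Real.sigmoid x = Real.exp x / (1 + Real.exp x) := by
  simpa using sigmoid_sub_eq x 0

/-- The solution of the Poisson equation of the score of one edge is bounded uniformly in the
true parameters `(t₀, t₁)`, as long as the score is evaluated near them. -/
theorem exists_poisson_solution {s₀ s₁ t₀ t₁ : ℝ} (h₀ : |s₀ - t₀| ≤ 1 / 2) (h₁ : |s₁ - t₁| ≤ 1 / 2)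
    (v₀ v₁ : ℝ) :
    ∃ h : ℝ, |h| ≤ 4 * (|v₀| + |v₁|) ∧
      h * (1 - Real.exp t₁ / (1 + Real.exp t₀ + Real.exp t₁)) =
        (Real.exp t₀ / (1 + Real.exp t₀ + Real.exp t₁) +
          Real.exp t₁ / (1 + Real.exp t₀ + Real.exp t₁)) *
          (v₀ + Real.sigmoid (s₁ - s₀) * (v₁ - v₀))
        - Real.exp t₀ / (1 + Real.exp t₀ + Real.exp t₁) * v₀
        - (1 - Real.exp t₀ / (1 + Real.exp t₀ + Real.exp t₁)) * (Real.sigmoid s₁ * v₁) := by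
  rw [sigmoid_sub_eq, sigmoid_eq]
  have e1 := exp_le_two_mul_exp h₀
  have e2 := exp_le_two_mul_exp h₁
  have e3 := exp_le_two_mul_exp (abs_sub_comm s₀ t₀ ▸ h₀)
  have e4 := exp_le_two_mul_exp (abs_sub_comm s₁ t₁ ▸ h₁)
  have hm := Real.exp_pos t₀
  have hk := Real.exp_pos t₁
  have hm' := Real.exp_pos s₀
  have hk' := Real.exp_pos s₁
  set m := Real.exp t₀
  set k := Real.exp t₁
  set m' := Real.exp s₀
  set k' := Real.exp s₁
  -- Multiplying the equation by `1 + m + k` turns `1 - P₁` into `1 + m`; `g₀` and `g₁` are then the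
  -- coefficients of `v₀` and `v₁` on the right. Both vanish at `s = t`, where the centered score is
  -- already a martingale.
  set g₀ : ℝ := (m + k) * m' / (m' + k') - m with hg₀
  set g₁ : ℝ := (m + k) * k' / (m' + k') - (1 + k) * k' / (1 + k') with hg₁
  have b₀ : |g₀| ≤ 4 * (1 + m) := by
    have h1 : (m + k) * m' / (m' + k') ≤ 4 * m := by
      rw [div_le_iff₀ (by positivity)]
      nlinarith
    have h2 : 0 ≤ (m + k) * m' / (m' + k') := by positivity
    rw [abs_le]
    constructor <;> linarith
  -- Both terms of `g₁` may be of size `k`, far above `1 + m`, but each equals `k` up to a multiple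
  -- of `1 + m`, so the large parts cancel.
  have b₁ : |g₁| ≤ 4 * (1 + m) := by
    have h1 : (m + k) * k' / (m' + k') ≤ k + m := by
      rw [div_le_iff₀ (by positivity)]
      nlinarith
    have h2 : k - 4 * m ≤ (m + k) * k' / (m' + k') := by
      rw [le_div_iff₀ (by positivity)]
      nlinarith
    have h3 : (1 + k) * k' / (1 + k') ≤ k + 1 := by
      rw [div_le_iff₀ (by positivity)]
      nlinarith
    have h4 : k - 1 ≤ (1 + k) * k' / (1 + k') := by
      rw [le_div_iff₀ (by positivity)]
      nlinarith
    rw [abs_le]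
    constructor <;> linarith
  refine ⟨(v₀ * g₀ + v₁ * g₁) / (1 + m), ?_, ?_⟩
  · rw [abs_div, abs_of_pos (by positivity : 0 < 1 + m), div_le_iff₀ (by positivity)]
    calc |v₀ * g₀ + v₁ * g₁| ≤ |v₀| * |g₀| + |v₁| * |g₁| := by
          rw [← abs_mul, ← abs_mul]
          exact abs_add_le _ _
      _ ≤ |v₀| * (4 * (1 + m)) + |v₁| * (4 * (1 + m)) := by gcongr
      _ = 4 * (|v₀| + |v₁|) * (1 + m) := by ring
  · rw [hg₀, hg₁]
    field_simp
    ring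

section Score

variable {Ω : Type*} [mΩ : MeasurableSpace Ω] {μ : Measure Ω}

theorem sum_Icc_one_eq_sum_range (n : ℕ) (f : ℕ → ℝ) :
    ∑ t ∈ Finset.Icc 1 n, f t = ∑ t ∈ Finset.range n, f (t + 1) := by
  induction n with
  | zero => simp
  | succ n ih => rw [Finset.sum_Icc_succ_top (by omega), Finset.sum_range_succ, ih]

/-- The centered score of one edge is sub-Gaussian, uniformly in the true parameters. -/
theorem IsTwoStateChain.subgaussian_edgeScore [IsProbabilityMeasure μ]
    {𝓕 : ℕ → MeasurableSpace Ω} {x ε : ℕ → Ω → ℤ} {t₀ t₁ s₀ s₁ : ℝ}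
    (h : IsTwoStateChain μ 𝓕 x ε (Real.exp t₀ / (1 + Real.exp t₀ + Real.exp t₁))
      (Real.exp t₁ / (1 + Real.exp t₀ + Real.exp t₁)))
    (h₀ : |s₀ - t₀| ≤ 1 / 2) (h₁ : |s₁ - t₁| ≤ 1 / 2) (v₀ v₁ : ℝ) {n : ℕ} (hn : 1 ≤ n)
    {W : Ω → ℝ}
    (hW : ∀ ω, W ω = edgeScore s₀ s₁ v₀ v₁ (∑ t ∈ Finset.Icc 1 n, (x t ω : ℝ))
      (∑ t ∈ Finset.Icc 1 n, (x t ω : ℝ) * (x (t - 1) ω : ℝ))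
      (∑ t ∈ Finset.Icc 1 n, (1 - (x t ω : ℝ)) * (1 - (x (t - 1) ω : ℝ)))) :
    HasSubgaussianMGF (fun ω => W ω - ∫ ω', W ω' ∂μ)
      (4 * n * (5 * (‖v₀‖₊ + ‖v₁‖₊)) ^ 2) μ := by
  obtain ⟨b, hb, hP⟩ := exists_poisson_solution h₀ h₁ v₀ v₁
  set q := Real.sigmoid (s₁ - s₀)
  set r := Real.sigmoid s₁
  have hq0 : 0 ≤ q := Real.sigmoid_nonneg _
  have hq1 : q ≤ 1 := Real.sigmoid_le_one _
  have hr0 : 0 ≤ r := Real.sigmoid_nonneg _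
  have hr1 : r ≤ 1 := Real.sigmoid_le_one _
  -- `5 = 4 + 1`: `4` from the Poisson solution, `1` from the score coefficients, whose sigmoid
  -- weights lie in `[0, 1]`.
  have hc : ((5 * (‖v₀‖₊ + ‖v₁‖₊) : ℝ≥0) : ℝ) = 5 * (|v₀| + |v₁|) := by simp
  have hv₀ := abs_nonneg v₀
  have hv₁ := abs_nonneg v₁
  refine h.subgaussian_additive v₀ (q * (v₁ - v₀)) (r * v₁) b _ hP ?_ ?_ ?_ hn fun ω => ?_
  · rw [hc]
    linarith
  · rw [hc]
    have h1 : |r * v₁| ≤ |v₁| := by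
      rw [abs_mul, abs_of_nonneg hr0]
      exact mul_le_of_le_one_left hv₁ hr1
    calc |v₀ - r * v₁ + b| ≤ |v₀| + |r * v₁| + |b| :=
          (abs_add_le _ _).trans (by gcongr; exact abs_sub _ _)
      _ ≤ 5 * (|v₀| + |v₁|) := by linarith
  · rw [hc]
    have h1 : |q * v₁| ≤ |v₁| := by
      rw [abs_mul, abs_of_nonneg hq0]
      exact mul_le_of_le_one_left hv₁ hq1
    have h2 : |(1 - q) * v₀| ≤ |v₀| := by
      rw [abs_mul, abs_of_nonneg (by linarith)]
      exact mul_le_of_le_one_left hv₀ (by linarith)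
    calc |v₀ + q * (v₁ - v₀) + b| = |(1 - q) * v₀ + q * v₁ + b| := by congr 1; ring
      _ ≤ |(1 - q) * v₀| + |q * v₁| + |b| :=
          (abs_add_le _ _).trans (by gcongr; exact abs_add_le _ _)
      _ ≤ 5 * (|v₀| + |v₁|) := by linarith
  · rw [hW, edgeScore, sum_Icc_one_eq_sum_range, sum_Icc_one_eq_sum_range,
      sum_Icc_one_eq_sum_range]
    simp only [Nat.add_sub_cancel, Finset.sum_add_distrib, ← Finset.mul_sum]
    ring

end Score

/-! ### Independence across edges and times. -/

section Driven

variable {p : ℕ} {Ω : Type*} {X : ℕ → Ω → Matrix (Fin p) (Fin p) ℤ} {ε : ℕ → Edge p → Ω → ℤ}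

/-- The independent sources of randomness: the initial edges, at time `0`, and the innovations. -/
def source (X : ℕ → Ω → Matrix (Fin p) (Fin p) ℤ) (ε : ℕ → Edge p → Ω → ℤ) (k : Edge p × ℕ)
    (ω : Ω) : ℤ :=
  if k.2 = 0 then X 0 ω k.1.1.1 k.1.1.2 else ε k.2 k.1 ω

/-- The σ-algebra generated by the sources with index in `S`. -/
@[reducible]
def sourceAlgebra (X : ℕ → Ω → Matrix (Fin p) (Fin p) ℤ) (ε : ℕ → Edge p → Ω → ℤ)
    (S : Set (Edge p × ℕ)) : MeasurableSpace Ω :=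
  ⨆ k ∈ S, MeasurableSpace.comap (source X ε k) inferInstance

theorem sourceAlgebra_mono {S T : Set (Edge p × ℕ)} (h : S ⊆ T) :
    sourceAlgebra X ε S ≤ sourceAlgebra X ε T :=
  biSup_mono fun _ hk => h hk

theorem comap_source_le_sourceAlgebra {S : Set (Edge p × ℕ)} {k : Edge p × ℕ} (hk : k ∈ S) :
    MeasurableSpace.comap (source X ε k) inferInstance ≤ sourceAlgebra X ε S :=
  le_biSup (fun k => MeasurableSpace.comap (source X ε k) inferInstance) hk

theorem measurable_source_sourceAlgebra {S : Set (Edge p × ℕ)} {k : Edge p × ℕ} (hk : k ∈ S) :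
    Measurable[sourceAlgebra X ε S] (source X ε k) :=
  (comap_measurable _).mono (comap_source_le_sourceAlgebra hk) le_rfl

variable [mΩ : MeasurableSpace Ω] {μ : Measure Ω} {θs : Param p}

namespace IsDrivenBy

theorem measurable_source (h : IsDrivenBy μ θs X ε) (k : Edge p × ℕ) :
    Measurable (source X ε k) := by
  by_cases hk : k.2 = 0
  · have : source X ε k = fun ω => X 0 ω k.1.1.1 k.1.1.2 := by funext ω; simp [source, hk]
    exact this ▸ h.measurable_init k.1
  · have : source X ε k = ε k.2 k.1 := by funext ω; simp [source, hk]
    exact this ▸ h.measurable_innov k.2 k.1 (by omega)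

theorem sourceAlgebra_le (h : IsDrivenBy μ θs X ε) (S : Set (Edge p × ℕ)) :
    sourceAlgebra X ε S ≤ mΩ :=
  iSup₂_le fun k _ => (h.measurable_source k).comap_le

theorem indep_sourceAlgebra (h : IsDrivenBy μ θs X ε) {S T : Set (Edge p × ℕ)}
    (hST : Disjoint S T) : Indep (sourceAlgebra X ε S) (sourceAlgebra X ε T) μ :=
  indep_iSup_of_disjoint (fun k => (h.measurable_source k).comap_le) h.indep.iIndep hST

theorem measurable_state (h : IsDrivenBy μ θs X ε) (e : Edge p) (t : ℕ) :
    Measurable[sourceAlgebra X ε {k | k.1 = e ∧ k.2 ≤ t}] fun ω => X t ω e.1.1 e.1.2 := by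
  induction t with
  | zero =>
    exact measurable_source_sourceAlgebra (X := X) (ε := ε) (k := (e, 0)) ⟨rfl, le_rfl⟩
  | succ t ih =>
    have h1 := ih.mono (sourceAlgebra_mono (X := X) (ε := ε)
      (T := {k | k.1 = e ∧ k.2 ≤ t + 1}) fun k hk => ⟨hk.1, hk.2.trans t.le_succ⟩) le_rfl
    have h2 : Measurable[sourceAlgebra X ε {k | k.1 = e ∧ k.2 ≤ t + 1}] (ε (t + 1) e) :=
      measurable_source_sourceAlgebra (X := X) (ε := ε) (k := (e, t + 1)) ⟨rfl, le_rfl⟩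
    have h3 (b : ℤ) : Measurable[sourceAlgebra X ε {k | k.1 = e ∧ k.2 ≤ t + 1}]
        fun ω => if ε (t + 1) e ω = b then (1 : ℤ) else 0 :=
      (measurable_of_countable fun z : ℤ => if z = b then (1 : ℤ) else 0).comp h2
    simp_rw [h.recursion t e]
    exact (h3 0).add (h1.mul (h3 1))

/-- The filtration uses only the sources of `e` up to time `t`, so independence from the next
innovation comes from disjoint index sets. -/
theorem isTwoStateChain (h : IsDrivenBy μ θs X ε) (e : Edge p) :
    IsTwoStateChain μ (fun t => sourceAlgebra X ε {k | k.1 = e ∧ k.2 ≤ t})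
      (fun t ω => X t ω e.1.1 e.1.2) (fun t => ε t e)
      (Real.exp (pairSum θs 0 e) / (1 + Real.exp (pairSum θs 0 e) + Real.exp (pairSum θs 1 e)))
      (Real.exp (pairSum θs 1 e) /
        (1 + Real.exp (pairSum θs 0 e) + Real.exp (pairSum θs 1 e))) where
  le _ := h.sourceAlgebra_le _
  mono _ _ hst := sourceAlgebra_mono fun _ hk => ⟨hk.1, hk.2.trans hst⟩
  adapted := h.measurable_state e
  zero_or_one t ω := h.zero_or_one t ω _ _
  measurable_innov t := h.measurable_innov (t + 1) e (by omega)
  indep t := by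
    refine indep_of_indep_of_le_right (h.indep_sourceAlgebra (T := {(e, t + 1)}) ?_)
      (comap_source_le_sourceAlgebra (X := X) (ε := ε) (k := (e, t + 1)) rfl)
    rw [Set.disjoint_singleton_right]
    rintro ⟨-, hk⟩
    simp at hk
  recursion t ω := h.recursion t e ω
  prob_zero t := h.prob_innov_zero (t + 1) e (by omega)
  prob_one t := h.prob_innov_one (t + 1) e (by omega)

/-- Sub-Gaussian variables attached to different edges add up as independent ones. -/
theorem subgaussian_sum (h : IsDrivenBy μ θs X ε) [IsProbabilityMeasure μ] {Y : Edge p → Ω → ℝ}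
    {c : Edge p → ℝ≥0} (hY : ∀ e, HasSubgaussianMGF (Y e) (c e) μ)
    (hm : ∀ e, Measurable[sourceAlgebra X ε {k | k.1 = e}] (Y e)) (s : Finset (Edge p)) :
    HasSubgaussianMGF (fun ω => ∑ e ∈ s, Y e ω) (∑ e ∈ s, c e) μ := by
  classical
  induction s using Finset.induction_on with
  | empty => simp
  | insert e s hes ih =>
    simp_rw [Finset.sum_insert hes]
    refine (hY e).add_of_indepFun ih ?_
    rw [IndepFun_iff_Indep]
    have hs : Measurable[sourceAlgebra X ε {k | k.1 ∈ s}] fun ω => ∑ e ∈ s, Y e ω :=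
      Finset.measurable_sum _ fun e' he' => (hm e').mono
        (sourceAlgebra_mono fun k (hk : k.1 = e') => by simpa [hk] using he') le_rfl
    refine indep_of_indep_of_le_left (indep_of_indep_of_le_right
      (h.indep_sourceAlgebra (S := {k | k.1 = e}) (T := {k | k.1 ∈ s}) ?_) hs.comap_le)
      (hm e).comap_le
    rw [Set.disjoint_left]
    rintro k (rfl : k.1 = e)
    exact hes

end IsDrivenBy

/-! ### Centered statistics. -/

/-- The deviation of a random variable from its mean. -/
def deviation (μ : Measure Ω) (f : Ω → ℝ) (ω : Ω) : ℝ :=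
  f ω - ∫ ω', f ω' ∂μ

/-- The statistic `a_{i,j}` minus its mean. -/
def devA (μ : Measure Ω) (n : ℕ) (X : ℕ → Ω → Matrix (Fin p) (Fin p) ℤ) (ω : Ω) (e : Edge p) : ℝ :=
  deviation μ (fun ω => statA n (fun t => X t ω) e) ω

/-- The statistic `b_{i,j}` minus its mean. -/
def devB (μ : Measure Ω) (n : ℕ) (X : ℕ → Ω → Matrix (Fin p) (Fin p) ℤ) (ω : Ω) (e : Edge p) : ℝ :=
  deviation μ (fun ω => statB n (fun t => X t ω) e) ω

/-- The statistic `d_{i,j}` minus its mean. -/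
def devD (μ : Measure Ω) (n : ℕ) (X : ℕ → Ω → Matrix (Fin p) (Fin p) ℤ) (ω : Ω) (e : Edge p) : ℝ :=
  deviation μ (fun ω => statD n (fun t => X t ω) e) ω

namespace IsDrivenBy

theorem cast_mem_Icc (h : IsDrivenBy μ θs X ε) (t : ℕ) (ω : Ω) (i j : Fin p) :
    (X t ω i j : ℝ) ∈ Set.Icc (0 : ℝ) 1 := by
  rcases h.zero_or_one t ω i j with h | h <;> simp [h]

theorem sum_Icc_mem (n : ℕ) {f : ℕ → ℝ} (hf : ∀ t, f t ∈ Set.Icc (0 : ℝ) 1) :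
    ∑ t ∈ Finset.Icc 1 n, f t ∈ Set.Icc (0 : ℝ) n := by
  refine ⟨Finset.sum_nonneg fun t _ => (hf t).1, ?_⟩
  simpa using Finset.sum_le_card_nsmul (Finset.Icc 1 n) f 1 fun t _ => (hf t).2

theorem statA_mem (h : IsDrivenBy μ θs X ε) (n : ℕ) (ω : Ω) (e : Edge p) :
    statA n (fun t => X t ω) e ∈ Set.Icc (0 : ℝ) n :=
  sum_Icc_mem n fun t => h.cast_mem_Icc t ω _ _

theorem statB_mem (h : IsDrivenBy μ θs X ε) (n : ℕ) (ω : Ω) (e : Edge p) :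
    statB n (fun t => X t ω) e ∈ Set.Icc (0 : ℝ) n :=
  sum_Icc_mem n fun t => unitInterval.mul_mem (h.cast_mem_Icc t ω _ _) (h.cast_mem_Icc _ ω _ _)

theorem statD_mem (h : IsDrivenBy μ θs X ε) (n : ℕ) (ω : Ω) (e : Edge p) :
    statD n (fun t => X t ω) e ∈ Set.Icc (0 : ℝ) n :=
  sum_Icc_mem n fun t => unitInterval.mul_mem
    (Set.Icc.mem_iff_one_sub_mem.1 (h.cast_mem_Icc t ω _ _))
    (Set.Icc.mem_iff_one_sub_mem.1 (h.cast_mem_Icc _ ω _ _))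

theorem measurable_cast (h : IsDrivenBy μ θs X ε) (t : ℕ) (e : Edge p) :
    Measurable[sourceAlgebra X ε {k | k.1 = e}] fun ω => (X t ω e.1.1 e.1.2 : ℝ) :=
  (measurable_of_countable fun z : ℤ => (z : ℝ)).comp
    ((h.measurable_state e t).mono (sourceAlgebra_mono fun _ hk => hk.1) le_rfl)

theorem measurable_statA (h : IsDrivenBy μ θs X ε) (n : ℕ) (e : Edge p) :
    Measurable[sourceAlgebra X ε {k | k.1 = e}] fun ω => statA n (fun t => X t ω) e :=
  Finset.measurable_sum _ fun t _ => h.measurable_cast t e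

theorem measurable_statB (h : IsDrivenBy μ θs X ε) (n : ℕ) (e : Edge p) :
    Measurable[sourceAlgebra X ε {k | k.1 = e}] fun ω => statB n (fun t => X t ω) e :=
  Finset.measurable_sum _ fun t _ => (h.measurable_cast t e).mul (h.measurable_cast (t - 1) e)

theorem measurable_statD (h : IsDrivenBy μ θs X ε) (n : ℕ) (e : Edge p) :
    Measurable[sourceAlgebra X ε {k | k.1 = e}] fun ω => statD n (fun t => X t ω) e :=
  Finset.measurable_sum _ fun t _ =>
    ((h.measurable_cast t e).const_sub 1).mul ((h.measurable_cast (t - 1) e).const_sub 1)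

variable [IsProbabilityMeasure μ]

theorem integrable_statA (h : IsDrivenBy μ θs X ε) (n : ℕ) (e : Edge p) :
    Integrable (fun ω => statA n (fun t => X t ω) e) μ :=
  Integrable.of_mem_Icc 0 n
    ((h.measurable_statA n e).mono (h.sourceAlgebra_le _) le_rfl).aemeasurable
    (Filter.Eventually.of_forall fun ω => h.statA_mem n ω e)

theorem integrable_statB (h : IsDrivenBy μ θs X ε) (n : ℕ) (e : Edge p) :
    Integrable (fun ω => statB n (fun t => X t ω) e) μ :=
  Integrable.of_mem_Icc 0 n
    ((h.measurable_statB n e).mono (h.sourceAlgebra_le _) le_rfl).aemeasurable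
    (Filter.Eventually.of_forall fun ω => h.statB_mem n ω e)

theorem integrable_statD (h : IsDrivenBy μ θs X ε) (n : ℕ) (e : Edge p) :
    Integrable (fun ω => statD n (fun t => X t ω) e) μ :=
  Integrable.of_mem_Icc 0 n
    ((h.measurable_statD n e).mono (h.sourceAlgebra_le _) le_rfl).aemeasurable
    (Filter.Eventually.of_forall fun ω => h.statD_mem n ω e)

theorem abs_deviation_le {f : Ω → ℝ} {C : ℝ} (hi : Integrable f μ)
    (hf : ∀ ω, f ω ∈ Set.Icc 0 C) (ω : Ω) : |deviation μ f ω| ≤ C := by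
  have h1 : 0 ≤ ∫ ω', f ω' ∂μ := integral_nonneg fun ω' => (hf ω').1
  have h2 : ∫ ω', f ω' ∂μ ≤ C := by
    simpa using integral_mono hi (integrable_const C) fun ω' => (hf ω').2
  rw [deviation, abs_le]
  constructor <;> linarith [(hf ω).1, (hf ω).2]

theorem abs_devA_le (h : IsDrivenBy μ θs X ε) (n : ℕ) (ω : Ω) (e : Edge p) :
    |devA μ n X ω e| ≤ n :=
  abs_deviation_le (h.integrable_statA n e) (fun ω => h.statA_mem n ω e) ω

theorem abs_devB_le (h : IsDrivenBy μ θs X ε) (n : ℕ) (ω : Ω) (e : Edge p) :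
    |devB μ n X ω e| ≤ n :=
  abs_deviation_le (h.integrable_statB n e) (fun ω => h.statB_mem n ω e) ω

theorem abs_devD_le (h : IsDrivenBy μ θs X ε) (n : ℕ) (ω : Ω) (e : Edge p) :
    |devD μ n X ω e| ≤ n :=
  abs_deviation_le (h.integrable_statD n e) (fun ω => h.statD_mem n ω e) ω

theorem subgaussian_edgeScore (h : IsDrivenBy μ θs X ε) {n : ℕ} (hn : 1 ≤ n) (e : Edge p)
    {s₀ s₁ : ℝ} (h₀ : |s₀ - pairSum θs 0 e| ≤ 1 / 2) (h₁ : |s₁ - pairSum θs 1 e| ≤ 1 / 2)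
    (v₀ v₁ : ℝ) :
    HasSubgaussianMGF (fun ω => edgeScore s₀ s₁ v₀ v₁ (devA μ n X ω e) (devB μ n X ω e)
      (devD μ n X ω e)) (4 * n * (5 * (‖v₀‖₊ + ‖v₁‖₊)) ^ 2) μ := by
  refine ((h.isTwoStateChain e).subgaussian_edgeScore h₀ h₁ v₀ v₁ hn (W := fun ω =>
    edgeScore s₀ s₁ v₀ v₁ (statA n (fun t => X t ω) e) (statB n (fun t => X t ω) e)
      (statD n (fun t => X t ω) e)) fun ω => rfl).congr (Filter.Eventually.of_forall fun ω => ?_)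
  have hA := h.integrable_statA n e
  have hB := h.integrable_statB n e
  have hD := h.integrable_statD n e
  have hAB : Integrable (fun ω => statA n (fun t => X t ω) e -
      Real.sigmoid (s₁ - s₀) * statB n (fun t => X t ω) e) μ := hA.sub (hB.const_mul _)
  have hDB : Integrable (fun ω => Real.sigmoid s₁ * statD n (fun t => X t ω) e +
      Real.sigmoid (s₁ - s₀) * statB n (fun t => X t ω) e) μ :=
    (hD.const_mul _).add (hB.const_mul _)
  simp only [edgeScore, devA, devB, devD, deviation]
  rw [integral_add (hAB.const_mul _) (hDB.const_mul _), integral_const_mul, integral_const_mul,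
    integral_sub hA (hB.const_mul _), integral_add (hD.const_mul _) (hB.const_mul _),
    integral_const_mul, integral_const_mul]
  ring

end IsDrivenBy

/-! ### Tail bound for the score of the whole network. -/

/-- The directional derivative at `θ` in the direction `u` of the log-likelihood, as a function of
the statistics `a`, `b`, `d` and up to its deterministic part. -/
def totalScore (θ u : Param p) (a b d : Edge p → ℝ) : ℝ :=
  ∑ e, edgeScore (pairSum θ 0 e) (pairSum θ 1 e) (pairSum u 0 e) (pairSum u 1 e) (a e) (b e) (d e)

/-- Each node meets fewer than `p` edges, so the cost is `p`, not the `p ^ 2` of a count of edges.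
Enlarging the sum to all ordered pairs makes it factor. -/
theorem sum_edge_sq_le (u : Param p) :
    ∑ e : Edge p, (|pairSum u 0 e| + |pairSum u 1 e|) ^ 2 ≤ 8 * p * ∑ k, u k ^ 2 := by
  set N : Fin p → ℝ := fun i => u (i, 0) ^ 2 + u (i, 1) ^ 2
  have h1 (e : Edge p) : (|pairSum u 0 e| + |pairSum u 1 e|) ^ 2 ≤ 4 * (N e.1.1 + N e.1.2) := by
    simp only [pairSum, N]
    have := sq_abs (u (e.1.1, 0) + u (e.1.2, 0))
    have := sq_abs (u (e.1.1, 1) + u (e.1.2, 1))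
    nlinarith [sq_nonneg (|u (e.1.1, 0) + u (e.1.2, 0)| - |u (e.1.1, 1) + u (e.1.2, 1)|),
      sq_nonneg (u (e.1.1, 0) - u (e.1.2, 0)), sq_nonneg (u (e.1.1, 1) - u (e.1.2, 1))]
  have hN (i : Fin p) : 0 ≤ N i := by positivity
  calc ∑ e : Edge p, (|pairSum u 0 e| + |pairSum u 1 e|) ^ 2
      ≤ ∑ e : Edge p, 4 * (N e.1.1 + N e.1.2) := Finset.sum_le_sum fun e _ => h1 e
    _ = ∑ e ∈ Finset.univ.filter (fun e : Fin p × Fin p => e.1 < e.2), 4 * (N e.1 + N e.2) :=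
        (Finset.sum_subtype (p := fun e : Fin p × Fin p => e.1 < e.2) _ (by simp)
          fun e => 4 * (N e.1 + N e.2)).symm
    _ ≤ ∑ e : Fin p × Fin p, 4 * (N e.1 + N e.2) :=
        Finset.sum_le_univ_sum_of_nonneg fun e => by have := hN e.1; have := hN e.2; positivity
    _ = 8 * p * ∑ k, u k ^ 2 := by
        rw [Fintype.sum_prod_type, Fintype.sum_prod_type]
        simp only [Fin.sum_univ_two, ← Finset.mul_sum, Finset.sum_add_distrib, Finset.sum_const,
          Finset.card_univ, Fintype.card_fin, nsmul_eq_mul, N]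
        ring

theorem abs_pairSum_sub_le {θ θ' : Param p} {δ : ℝ} (h : ∀ k, |θ k - θ' k| ≤ δ) (r : Fin 2)
    (e : Edge p) : |pairSum θ r e - pairSum θ' r e| ≤ 2 * δ := by
  have h1 := h (e.1.1, r)
  have h2 := h (e.1.2, r)
  simp only [pairSum]
  rw [abs_le] at *
  constructor <;> linarith

/-- Tail bound for the directional derivative of the deviation of the log-likelihood. -/
theorem IsDrivenBy.measure_totalScore_ge_le [IsProbabilityMeasure μ] (h : IsDrivenBy μ θs X ε)
    {n : ℕ} (hn : 1 ≤ n) {θ u : Param p} (hθ : ∀ k, |θ k - θs k| ≤ 1 / 4) {R : ℝ}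
    (hR : ∑ k, u k ^ 2 ≤ R) (hRpos : 0 < R) (hp : 1 ≤ p) {τ : ℝ} (hτ : 0 ≤ τ) :
    μ.real {ω | τ ≤ |totalScore θ u (devA μ n X ω) (devB μ n X ω) (devD μ n X ω)|} ≤
      2 * Real.exp (-τ ^ 2 / (1600 * n * p * R)) := by
  have hp' : (1 : ℝ) ≤ p := by exact_mod_cast hp
  have hn' : (1 : ℝ) ≤ n := by exact_mod_cast hn
  have hs := h.subgaussian_sum (fun e => h.subgaussian_edgeScore hn e
    (s₀ := pairSum θ 0 e) (s₁ := pairSum θ 1 e)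
    (by have := abs_pairSum_sub_le hθ 0 e; linarith)
    (by have := abs_pairSum_sub_le hθ 1 e; linarith)
    (pairSum u 0 e) (pairSum u 1 e)) (fun e => by
      have hA : Measurable[sourceAlgebra X ε {k | k.1 = e}] fun ω => devA μ n X ω e :=
        (h.measurable_statA n e).sub_const _
      have hB : Measurable[sourceAlgebra X ε {k | k.1 = e}] fun ω => devB μ n X ω e :=
        (h.measurable_statB n e).sub_const _
      have hD : Measurable[sourceAlgebra X ε {k | k.1 = e}] fun ω => devD μ n X ω e :=
        (h.measurable_statD n e).sub_const _
      exact ((hA.sub (hB.const_mul _)).const_mul _).add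
        (((hD.const_mul _).add (hB.const_mul _)).const_mul _)) Finset.univ
  -- `800 = 4 * 5 ^ 2 * 8`; the Chernoff bound doubles it to `1600`.
  have hc : ∑ e : Edge p, (4 * n * (5 * (‖pairSum u 0 e‖₊ + ‖pairSum u 1 e‖₊)) ^ 2 : ℝ≥0) ≤
      (800 * n * p * ⟨R, hRpos.le⟩ : ℝ≥0) := by
    rw [← NNReal.coe_le_coe]
    push_cast
    calc ∑ e : Edge p, 4 * (n : ℝ) * (5 * (‖pairSum u 0 e‖ + ‖pairSum u 1 e‖)) ^ 2
        = 100 * n * ∑ e : Edge p, (|pairSum u 0 e| + |pairSum u 1 e|) ^ 2 := by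
          rw [Finset.mul_sum]
          refine Finset.sum_congr rfl fun e _ => ?_
          simp only [Real.norm_eq_abs]
          ring
      _ ≤ 100 * n * (8 * p * R) := by
          gcongr
          exact (sum_edge_sq_le u).trans (by gcongr)
      _ = 800 * n * p * R := by ring
  have hs' := HasSubgaussianMGF.mono hs hc
  have h1 := hs'.measure_ge_le hτ
  have h2 := hs'.neg.measure_ge_le hτ
  have hcoe : ((800 * n * p * ⟨R, hRpos.le⟩ : ℝ≥0) : ℝ) = 800 * n * p * R := rfl
  rw [hcoe, show 2 * (800 * (n : ℝ) * p * R) = 1600 * n * p * R by ring] at h1 h2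
  calc μ.real {ω | τ ≤ |totalScore θ u (devA μ n X ω) (devB μ n X ω) (devD μ n X ω)|}
      ≤ μ.real ({ω | τ ≤ totalScore θ u (devA μ n X ω) (devB μ n X ω) (devD μ n X ω)} ∪
          {ω | τ ≤ -totalScore θ u (devA μ n X ω) (devB μ n X ω) (devD μ n X ω)}) :=
        measureReal_mono fun ω (hω : τ ≤ |_|) => le_abs.1 hω
    _ ≤ _ := measureReal_union_le _ _
    _ ≤ _ := by
        rw [two_mul]
        exact add_le_add h1 h2

end Driven

/-! ### Mean value and Lipschitz estimates for the log-likelihood. -/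

section LogLik

variable {p : ℕ}

/-- The part of the log-likelihood that depends on the statistics `a`, `b`, `d`. -/
def logLik (θ : Param p) (a b d : Edge p → ℝ) : ℝ :=
  ∑ e, (pairSum θ 0 e * a e + Real.log (1 + Real.exp (pairSum θ 1 e)) * d e
    + Real.log (1 + Real.exp (pairSum θ 1 e - pairSum θ 0 e)) * b e)

theorem pairSum_add_smul (θ u : Param p) (c : ℝ) (r : Fin 2) (e : Edge p) :
    pairSum (θ + c • u) r e = pairSum θ r e + c * pairSum u r e := by
  simp [pairSum]
  ring

theorem totalScore_smul (θ u : Param p) (c : ℝ) (a b d : Edge p → ℝ) :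
    totalScore θ (c • u) a b d = c * totalScore θ u a b d := by
  have h (r : Fin 2) (e : Edge p) : pairSum (c • u) r e = c * pairSum u r e := by
    simp [pairSum]
    ring
  rw [totalScore, totalScore, Finset.mul_sum]
  refine Finset.sum_congr rfl fun e _ => ?_
  rw [h, h, edgeScore, edgeScore]
  ring

theorem hasDerivAt_log_one_add_exp {g : ℝ → ℝ} {g' x : ℝ} (hg : HasDerivAt g g' x) :
    HasDerivAt (fun y => Real.log (1 + Real.exp (g y))) (Real.sigmoid (g x) * g') x := by
  have h := (hg.exp.const_add 1).log (by positivity)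
  refine h.congr_deriv ?_
  rw [sigmoid_eq]
  ring

theorem hasDerivAt_logLik (θ u : Param p) (a b d : Edge p → ℝ) (x : ℝ) :
    HasDerivAt (fun y : ℝ => logLik (θ + y • u) a b d) (totalScore (θ + x • u) u a b d) x := by
  refine HasDerivAt.fun_sum fun e _ => ?_
  have hs (r : Fin 2) : HasDerivAt (fun y : ℝ => pairSum (θ + y • u) r e) (pairSum u r e) x := by
    simp_rw [pairSum_add_smul]
    simpa using ((hasDerivAt_id x).mul_const (pairSum u r e)).const_add (pairSum θ r e)
  refine ((((hs 0).mul_const (a e)).add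
    ((hasDerivAt_log_one_add_exp (hs 1)).mul_const (d e))).add
    ((hasDerivAt_log_one_add_exp ((hs 1).sub (hs 0))).mul_const (b e))).congr_deriv ?_
  simp only [edgeScore, Pi.sub_apply]
  ring

/-- Mean value theorem on the segment. The point `x` depends on the statistics, hence on the
outcome, which is why a uniform bound on the score is needed. -/
theorem exists_logLik_sub_eq (θ θs : Param p) (a b d : Edge p → ℝ) :
    ∃ x ∈ Set.Ioo (0 : ℝ) 1, logLik θ a b d - logLik θs a b d =
      totalScore (θs + x • (θ - θs)) (θ - θs) a b d := by
  have hd := hasDerivAt_logLik θs (θ - θs) a b d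
  obtain ⟨x, hx, h⟩ := exists_hasDerivAt_eq_slope _ _ (zero_lt_one' ℝ)
    (fun y _ => (hd y).continuousAt.continuousWithinAt) fun y _ => hd y
  refine ⟨x, hx, ?_⟩
  rw [h]
  simp

theorem abs_sigmoid_sub_le (x y : ℝ) : |Real.sigmoid x - Real.sigmoid y| ≤ |x - y| := by
  have h := Convex.norm_image_sub_le_of_norm_hasDerivWithin_le (s := Set.univ)
    (f := Real.sigmoid) (C := 1) (fun z _ => (Real.hasDerivAt_sigmoid z).hasDerivWithinAt)
    (fun z _ => ?_) convex_univ (Set.mem_univ y) (Set.mem_univ x)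
  · simpa using h
  · have h0 := Real.sigmoid_nonneg z
    have h1 := Real.sigmoid_le_one z
    rw [Real.norm_eq_abs, abs_of_nonneg (mul_nonneg h0 (by linarith))]
    nlinarith

theorem abs_edgeScore_sub_le {s₀ s₁ v₀ v₁ s₀' s₁' v₀' v₁' a b d η N : ℝ}
    (ha : |a| ≤ N) (hb : |b| ≤ N) (hd : |d| ≤ N)
    (h₀ : |s₀ - s₀'| ≤ η) (h₁ : |s₁ - s₁'| ≤ η) (hv₀ : |v₀ - v₀'| ≤ η) (hv₁ : |v₁ - v₁'| ≤ η)
    (hv₀' : |v₀'| ≤ 2) (hv₁' : |v₁'| ≤ 2) :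
    |edgeScore s₀ s₁ v₀ v₁ a b d - edgeScore s₀' s₁' v₀' v₁' a b d| ≤ 14 * η * N := by
  have hN : 0 ≤ N := (abs_nonneg a).trans ha
  have hη : 0 ≤ η := (abs_nonneg _).trans h₀
  set q := Real.sigmoid (s₁ - s₀)
  set q' := Real.sigmoid (s₁' - s₀')
  set r := Real.sigmoid s₁
  set r' := Real.sigmoid s₁'
  have hq : |q| ≤ 1 := by
    rw [abs_of_nonneg (Real.sigmoid_nonneg _)]
    exact Real.sigmoid_le_one _
  have hr : |r| ≤ 1 := by
    rw [abs_of_nonneg (Real.sigmoid_nonneg _)]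
    exact Real.sigmoid_le_one _
  have hqq : |q - q'| ≤ 2 * η := by
    refine (abs_sigmoid_sub_le _ _).trans ?_
    rw [show s₁ - s₀ - (s₁' - s₀') = (s₁ - s₁') - (s₀ - s₀') by ring]
    exact (abs_sub _ _).trans (by linarith)
  have hrr : |r - r'| ≤ η := (abs_sigmoid_sub_le _ _).trans h₁
  have bnd {x y A B : ℝ} (hx : |x| ≤ A) (hy : |y| ≤ B) : |x * y| ≤ A * B := by
    rw [abs_mul]
    exact mul_le_mul hx hy (abs_nonneg _) ((abs_nonneg _).trans hx)
  have e1 := bnd hv₀ ha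
  have e2 := bnd (bnd hv₀ hq) hb
  have e3 := bnd (bnd hv₀' hqq) hb
  have e4 := bnd (bnd hv₁ hr) hd
  have e5 := bnd (bnd hv₁ hq) hb
  have e6 := bnd (bnd hv₁' hrr) hd
  have e7 := bnd (bnd hv₁' hqq) hb
  -- Telescoping one factor at a time; in units of `η * N` the seven terms cost `1 + 1 + 4 + 1 + 1 +
  -- 2 + 4 = 14`.
  have heq : edgeScore s₀ s₁ v₀ v₁ a b d - edgeScore s₀' s₁' v₀' v₁' a b d =
      (v₀ - v₀') * a - (v₀ - v₀') * q * b - v₀' * (q - q') * b + (v₁ - v₁') * r * d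
        + (v₁ - v₁') * q * b + v₁' * (r - r') * d + v₁' * (q - q') * b := by
    simp only [edgeScore]
    ring
  rw [heq, abs_le]
  simp only [abs_le] at e1 e2 e3 e4 e5 e6 e7
  constructor <;> linarith [e1.1, e1.2, e2.1, e2.2, e3.1, e3.2, e4.1, e4.2, e5.1, e5.2, e6.1, e6.2,
    e7.1, e7.2]

theorem card_edge_le (p : ℕ) : Fintype.card (Edge p) ≤ p ^ 2 := by
  refine (Fintype.card_subtype_le _).trans ?_
  simp [sq]

/-- No cancellation between edges is used: with `N = n` and `δ = 1 / (n p)` the bound is `28 p`,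
small enough after division by `n p`. -/
theorem abs_totalScore_sub_le {θ θ' u u' : Param p} {a b d : Edge p → ℝ} {N δ : ℝ}
    (ha : ∀ e, |a e| ≤ N) (hb : ∀ e, |b e| ≤ N) (hd : ∀ e, |d e| ≤ N) (hN : 0 ≤ N)
    (hδ : 0 ≤ δ) (hθ : ∀ k, |θ k - θ' k| ≤ δ) (hu : ∀ k, |u k - u' k| ≤ δ)
    (hu' : ∀ k, |u' k| ≤ 1) :
    |totalScore θ u a b d - totalScore θ' u' a b d| ≤ 28 * δ * N * p ^ 2 := by
  have hv (r : Fin 2) (e : Edge p) : |pairSum u' r e| ≤ 2 := by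
    have := abs_pairSum_sub_le (θ := u') (θ' := 0) (δ := 1) (by simpa using hu') r e
    simpa [pairSum] using this
  rw [totalScore, totalScore, ← Finset.sum_sub_distrib]
  calc _ ≤ ∑ e : Edge p, 14 * (2 * δ) * N := (Finset.abs_sum_le_sum_abs _ _).trans <|
        Finset.sum_le_sum fun e _ => abs_edgeScore_sub_le (ha e) (hb e) (hd e)
          (abs_pairSum_sub_le hθ 0 e) (abs_pairSum_sub_le hθ 1 e) (abs_pairSum_sub_le hu 0 e)
          (abs_pairSum_sub_le hu 1 e) (hv 0 e) (hv 1 e)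
    _ = 28 * δ * N * Fintype.card (Edge p) := by
        rw [Finset.sum_const, Finset.card_univ, nsmul_eq_mul]
        ring
    _ ≤ 28 * δ * N * p ^ 2 := by
        gcongr
        exact_mod_cast card_edge_le p

/-! ### Discretization. -/

/-- The vectors of integers between `-M` and `M`. -/
def grid (p M : ℕ) : Finset (Fin p × Fin 2 → ℤ) :=
  Fintype.piFinset fun _ => Finset.Icc (-M : ℤ) M

/-- The point of mesh `1 / M` with integer coordinates `k`. -/
def gridPoint {p : ℕ} (M : ℕ) (k : Fin p × Fin 2 → ℤ) : Param p :=
  WithLp.toLp 2 fun j => (k j : ℝ) / M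

theorem card_grid (p M : ℕ) : (grid p M).card = (2 * M + 1) ^ (2 * p) := by
  rw [grid, Fintype.card_piFinset]
  simp only [Int.card_Icc, Finset.prod_const, Finset.card_univ, Fintype.card_prod,
    Fintype.card_fin]
  congr 1
  · omega
  · ring

theorem abs_gridPoint_le {M : ℕ} {k : Fin p × Fin 2 → ℤ} (hk : k ∈ grid p M)
    (j : Fin p × Fin 2) : |gridPoint M k j| ≤ 1 := by
  rw [grid, Fintype.mem_piFinset] at hk
  have h := Finset.mem_Icc.1 (hk j)
  have h1 : (-M : ℝ) ≤ k j := by exact_mod_cast h.1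
  have h2 : (k j : ℝ) ≤ M := by exact_mod_cast h.2
  rw [gridPoint, abs_div, Nat.abs_cast]
  exact div_le_one_of_le₀ (abs_le.2 ⟨h1, h2⟩) (Nat.cast_nonneg _)

theorem exists_mem_grid {M : ℕ} (hM : 1 ≤ M) {u : Param p} (hu : ∀ j, |u j| ≤ 1) :
    ∃ k ∈ grid p M, ∀ j, |u j - gridPoint M k j| ≤ 1 / M := by
  have hM' : (0 : ℝ) < M := by exact_mod_cast hM
  refine ⟨fun j => ⌊u j * M⌋, ?_, fun j => ?_⟩
  · rw [grid, Fintype.mem_piFinset]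
    intro j
    have h := abs_le.1 (hu j)
    rw [Finset.mem_Icc]
    constructor
    · rw [Int.le_floor]
      push_cast
      nlinarith
    · have h1 : ((⌊u j * M⌋ : ℤ) : ℝ) ≤ M := (Int.floor_le _).trans (by nlinarith)
      exact_mod_cast h1
  · have h1 := Int.floor_le (u j * M)
    have h2 := Int.lt_floor_add_one (u j * M)
    have h3 : u j - gridPoint M (fun j => ⌊u j * M⌋) j = (u j * M - ⌊u j * M⌋) / M := by
      simp only [gridPoint]
      field_simp
    rw [h3, abs_div, abs_of_pos hM', div_le_div_iff_of_pos_right hM', abs_le]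
    constructor <;> linarith

theorem sum_sq_le_of_close {u u' : Param p} {δ : ℝ} (h : ∀ j, |u j - u' j| ≤ δ) :
    ∑ j, u' j ^ 2 ≤ 2 * ∑ j, u j ^ 2 + 4 * p * δ ^ 2 := by
  calc ∑ j, u' j ^ 2 ≤ ∑ j, (2 * u j ^ 2 + 2 * δ ^ 2) := Finset.sum_le_sum fun j _ => by
        have h1 : (u j - u' j) ^ 2 ≤ δ ^ 2 := sq_le_sq' (by linarith [(abs_le.1 (h j)).1])
          (abs_le.1 (h j)).2
        nlinarith [sq_nonneg (2 * u j - u' j)]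
    _ = 2 * ∑ j, u j ^ 2 + 4 * p * δ ^ 2 := by
        rw [Finset.sum_add_distrib, ← Finset.mul_sum, Finset.sum_const, Finset.card_univ,
          Fintype.card_prod, Fintype.card_fin, Fintype.card_fin, nsmul_eq_mul]
        push_cast
        ring

end LogLik

/-! ### Union bound and uniform concentration. -/

section Concentration

variable {p : ℕ} {Ω : Type*} [mΩ : MeasurableSpace Ω] {μ : Measure Ω} {θs : Param p}
  {X : ℕ → Ω → Matrix (Fin p) (Fin p) ℤ} {ε : ℕ → Edge p → Ω → ℤ}

theorem IsDrivenBy.randLoss_sub_expLoss [IsProbabilityMeasure μ] (h : IsDrivenBy μ θs X ε)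
    (n : ℕ) (θ : Param p) (ω : Ω) :
    randLoss n X θ ω - expLoss μ n X θ =
      -(1 / ((n : ℝ) * p)) * logLik θ (devA μ n X ω) (devB μ n X ω) (devD μ n X ω) := by
  have hA := h.integrable_statA n
  have hB := h.integrable_statB n
  have hD := h.integrable_statD n
  have hAD (e : Edge p) : Integrable (fun ω => pairSum θ 0 e * statA n (fun t => X t ω) e
      + Real.log (1 + Real.exp (pairSum θ 1 e)) * statD n (fun t => X t ω) e) μ :=
    ((hA e).const_mul _).add ((hD e).const_mul _)
  have hAll (e : Edge p) : Integrable (fun ω => pairSum θ 0 e * statA n (fun t => X t ω) e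
      + Real.log (1 + Real.exp (pairSum θ 1 e)) * statD n (fun t => X t ω) e
      + Real.log (1 + Real.exp (pairSum θ 1 e - pairSum θ 0 e)) * statB n (fun t => X t ω) e) μ :=
    (hAD e).add ((hB e).const_mul _)
  simp only [expLoss, randLoss, loss]
  rw [integral_sub (integrable_const _) ((integrable_finsetSum _ fun e _ => hAll e).const_mul _),
    integral_const_mul (1 / ((n : ℝ) * p)), integral_finsetSum _ fun e _ => hAll e]
  simp only [integral_const, probReal_univ, smul_eq_mul, one_mul]
  rw [sub_sub_sub_cancel_left, ← mul_sub, ← Finset.sum_sub_distrib, neg_mul, ← mul_neg,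
    logLik, ← Finset.sum_neg_distrib]
  congr 1
  refine Finset.sum_congr rfl fun e _ => ?_
  rw [integral_add (hAD e) ((hB e).const_mul _), integral_add ((hA e).const_mul _)
    ((hD e).const_mul _), integral_const_mul, integral_const_mul, integral_const_mul]
  simp only [devA, devB, devD, deviation]
  ring

theorem rate_nonneg {n p : ℕ} (hn : 1 ≤ n) (hp : 1 ≤ p) : 0 ≤ rate n p := by
  have h : 0 ≤ Real.log ((n : ℝ) * p) := Real.log_nonneg (by exact_mod_cast Nat.mul_pos hn hp)
  rw [rate]
  positivity

theorem sqrt_le_rate {n p : ℕ} (hn : 1 ≤ n) (hp : 1 ≤ p) :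
    Real.sqrt (Real.log ((n : ℝ) * p) / n) ≤ rate n p := by
  have h : 0 ≤ Real.log ((n : ℝ) * p) := Real.log_nonneg (by exact_mod_cast Nat.mul_pos hn hp)
  exact le_mul_of_one_le_left (Real.sqrt_nonneg _) (le_add_of_nonneg_right (by positivity))

/-- Absorbs the rounding error into the rate; `2 ≤ n * p` keeps the logarithm away from `0`. -/
theorem one_div_le_two_mul_sqrt {n p : ℕ} (hn : 1 ≤ n) (hnp : 2 ≤ n * p) :
    1 / (n : ℝ) ≤ 2 * Real.sqrt (Real.log ((n : ℝ) * p) / n) := by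
  have hn' : (1 : ℝ) ≤ n := by exact_mod_cast hn
  have hnp' : (2 : ℝ) ≤ n * p := by exact_mod_cast hnp
  have hL : 1 / 4 ≤ Real.log ((n : ℝ) * p) := by
    linarith [Real.log_two_gt_d9, Real.log_le_log two_pos hnp']
  rw [← div_le_iff₀' two_pos]
  refine Real.le_sqrt_of_sq_le ?_
  rw [div_div, div_pow, le_div_iff₀ (by linarith)]
  have : (1 : ℝ) ^ 2 / (n * 2) ^ 2 * n = 1 / 4 * (1 / n) := by field_simp; norm_num
  rw [this]
  have h1 : 1 / (n : ℝ) ≤ 1 := by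
    rw [div_le_one (by linarith)]
    exact hn'
  linarith

/-- The level below which the score stays on the grid points. -/
def scoreLevel (c : ℝ) (n p : ℕ) : ℝ :=
  Real.sqrt (9600 * (14 + c)) * (n * p * Real.sqrt (Real.log ((n : ℝ) * p) / n))

/-- The pairs of a grid point, for the parameter, and a grid point of bounded norm, for the
direction. -/
def gridPairs (n p : ℕ) : Finset ((Fin p × Fin 2 → ℤ) × (Fin p × Fin 2 → ℤ)) :=
  (grid p (n * p) ×ˢ grid p (n * p)).filter fun k => ∑ j, gridPoint (p := p) (n * p) k.2 j ^ 2 ≤ 6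

/-- The score is above its level at some grid point. -/
def badEvent (μ : Measure Ω) (θs : Param p) (c : ℝ) (n : ℕ)
    (X : ℕ → Ω → Matrix (Fin p) (Fin p) ℤ) : Set Ω :=
  ⋃ k ∈ gridPairs n p, {ω | scoreLevel c n p ≤ |totalScore
    (θs + (1 / 4 : ℝ) • gridPoint (n * p) k.1) (gridPoint (n * p) k.2)
    (devA μ n X ω) (devB μ n X ω) (devD μ n X ω)|}

theorem card_gridPairs_le (n p : ℕ) (hnp : 2 ≤ n * p) :
    (gridPairs n p).card ≤ (n * p) ^ (12 * p) := by
  refine (Finset.card_filter_le _ _).trans ?_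
  rw [Finset.card_product, card_grid]
  have h : 2 * (n * p) + 1 ≤ (n * p) ^ 3 := by
    generalize n * p = m at hnp
    nlinarith [Nat.mul_le_mul (Nat.mul_le_mul hnp hnp) (le_refl m)]
  calc (2 * (n * p) + 1) ^ (2 * p) * (2 * (n * p) + 1) ^ (2 * p)
      = (2 * (n * p) + 1) ^ (4 * p) := by rw [← pow_add]; ring_nf
    _ ≤ ((n * p) ^ 3) ^ (4 * p) := Nat.pow_le_pow_left h _
    _ = (n * p) ^ (12 * p) := by rw [← pow_mul]; ring_nf

theorem IsDrivenBy.measure_badEvent_lt [IsProbabilityMeasure μ] (h : IsDrivenBy μ θs X ε)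
    {c : ℝ} (hc : 0 < c) {n : ℕ} (hn : 1 ≤ n) (hp : 1 ≤ p) (hnp : 2 ≤ n * p) :
    μ.real (badEvent μ θs c n X) < ((n : ℝ) * p) ^ (-c) := by
  have hn' : (1 : ℝ) ≤ n := by exact_mod_cast hn
  have hp' : (1 : ℝ) ≤ p := by exact_mod_cast hp
  have hnp' : (2 : ℝ) ≤ n * p := by exact_mod_cast hnp
  have hnp0 : (0 : ℝ) < n * p := by linarith
  set L := Real.log ((n : ℝ) * p) with hL
  have hLpos : 0 < L := Real.log_pos (by linarith)
  have hexp : Real.exp L = n * p := Real.exp_log hnp0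
  -- The `9600` in `scoreLevel` is `1600 * 6`, with `6` the bound on the squared norm of grid
  -- directions.
  have hlevel : -scoreLevel c n p ^ 2 / (1600 * n * p * 6) = -((14 + c) * p * L) := by
    rw [scoreLevel, mul_pow, mul_pow, Real.sq_sqrt (by positivity), Real.sq_sqrt (by positivity)]
    field_simp
    ring
  have htail (k) (hk : k ∈ gridPairs n p) : μ.real {ω | scoreLevel c n p ≤ |totalScore
      (θs + (1 / 4 : ℝ) • gridPoint (n * p) k.1) (gridPoint (n * p) k.2)
      (devA μ n X ω) (devB μ n X ω) (devD μ n X ω)|} ≤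
      2 * Real.exp (-((14 + c) * p * L)) := by
    rw [gridPairs, Finset.mem_filter, Finset.mem_product] at hk
    rw [← hlevel]
    refine h.measure_totalScore_ge_le hn (fun j => ?_) hk.2 (by norm_num) hp
      (by rw [scoreLevel]; positivity)
    have h1 := abs_gridPoint_le hk.1.1 j
    simp only [PiLp.add_apply, PiLp.smul_apply, smul_eq_mul, add_sub_cancel_left, abs_mul]
    rw [abs_of_pos (by norm_num : (0 : ℝ) < 1 / 4)]
    linarith
  calc μ.real (badEvent μ θs c n X)
      ≤ ∑ k ∈ gridPairs n p, 2 * Real.exp (-((14 + c) * p * L)) :=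
        (measureReal_biUnion_finset_le _ _).trans (Finset.sum_le_sum htail)
    _ = (gridPairs n p).card * (2 * Real.exp (-((14 + c) * p * L))) := by
        rw [Finset.sum_const, nsmul_eq_mul]
    _ ≤ ((n : ℝ) * p) ^ (12 * p) * (((n : ℝ) * p) * Real.exp (-((14 + c) * p * L))) := by
        gcongr
        exact_mod_cast card_gridPairs_le n p hnp
    _ = Real.exp (12 * p * L + L - (14 + c) * p * L) := by
        rw [← hexp, ← Real.exp_nat_mul, ← Real.exp_add, ← Real.exp_add]
        push_cast
        ring_nf
    _ < Real.exp (L * -c) := by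
        rw [Real.exp_lt_exp]
        -- Of the `14`, `12` pays for the number of grid pairs, `1` for the factor `2 ≤ n * p`, and
        -- `1` makes the inequality strict.
        nlinarith [mul_le_mul_of_nonneg_right hp' hLpos.le,
          mul_le_mul_of_nonneg_right hp' (mul_nonneg hc.le hLpos.le)]
    _ = ((n : ℝ) * p) ^ (-c) := (Real.rpow_def_of_pos hnp0 _).symm

theorem abs_apply_sub_le_of_mem_linftyBall {ι : Type*} [Fintype ι] {x y : EuclideanSpace ℝ ι}
    {r : ℝ} (h : y ∈ linftyBall x r) (k : ι) : |y k - x k| ≤ r :=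
  (norm_le_pi_norm (WithLp.ofLp y - WithLp.ofLp x) k).trans h

/-- Outside the bad event, the deviation of the loss satisfies the uniform bound. -/
theorem IsDrivenBy.abs_loss_deviation_le [IsProbabilityMeasure μ] (h : IsDrivenBy μ θs X ε)
    {c α : ℝ} (hα : α ≤ 1 / 4) {n : ℕ} (hn : 1 ≤ n) (hp : 1 ≤ p) (hnp : 2 ≤ n * p) {ω : Ω}
    (hω : ω ∉ badEvent μ θs c n X) {θ : Param p} (hθ : θ ∈ linftyBall θs α) :
    |(randLoss n X θ ω - randLoss n X θs ω) - (expLoss μ n X θ - expLoss μ n X θs)| ≤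
      (Real.sqrt (9600 * (14 + c)) + 56) * rate n p * ‖θ - θs‖ := by
  have hn' : (1 : ℝ) ≤ n := by exact_mod_cast hn
  have hp' : (1 : ℝ) ≤ p := by exact_mod_cast hp
  have hnp' : (2 : ℝ) ≤ n * p := by exact_mod_cast hnp
  have hnp0 : (0 : ℝ) < n * p := by linarith
  have hdiff : (randLoss n X θ ω - randLoss n X θs ω) - (expLoss μ n X θ - expLoss μ n X θs) =
      -(1 / ((n : ℝ) * p)) * (logLik θ (devA μ n X ω) (devB μ n X ω) (devD μ n X ω) -
        logLik θs (devA μ n X ω) (devB μ n X ω) (devD μ n X ω)) := by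
    rw [mul_sub, ← h.randLoss_sub_expLoss, ← h.randLoss_sub_expLoss]
    ring
  rcases eq_or_ne θ θs with rfl | hne
  · simp
  set δ := ‖θ - θs‖ with hδ
  have hδpos : 0 < δ := norm_pos_iff.2 (sub_ne_zero.2 hne)
  set u : Param p := δ⁻¹ • (θ - θs) with hu
  have hθu : θ - θs = δ • u := by rw [hu, smul_inv_smul₀ hδpos.ne']
  have hunorm : ∑ j, u j ^ 2 = 1 := by
    rw [← EuclideanSpace.real_norm_sq_eq, hu, norm_smul, norm_inv, Real.norm_eq_abs,
      abs_of_pos hδpos, inv_mul_cancel₀ hδpos.ne', one_pow]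
  have hu1 (j) : |u j| ≤ 1 := by
    rw [← sq_le_one_iff_abs_le_one, ← hunorm]
    exact Finset.single_le_sum (f := fun j => u j ^ 2) (fun j _ => sq_nonneg _) (Finset.mem_univ j)
  obtain ⟨x, hx, hmv⟩ := exists_logLik_sub_eq θ θs (devA μ n X ω) (devB μ n X ω) (devD μ n X ω)
  set ξ : Param p := θs + x • (θ - θs) with hξ
  -- The displacement is at most `1 / 4` per coordinate, so it is scaled by `4` to fill the cube of
  -- the grid; `ξ'` scales it back.
  have hξ1 (j) : |((4 * x) • (θ - θs)) j| ≤ 1 := by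
    have h1 := abs_apply_sub_le_of_mem_linftyBall hθ j
    simp only [PiLp.smul_apply, PiLp.sub_apply, smul_eq_mul, abs_mul]
    rw [abs_of_pos (by linarith [hx.1] : 0 < x), abs_of_pos (by norm_num : (0 : ℝ) < 4)]
    nlinarith [hx.1, hx.2, abs_nonneg (θ j - θs j)]
  have hM : 1 ≤ n * p := by omega
  obtain ⟨k, hk, hkξ⟩ := exists_mem_grid hM hξ1
  obtain ⟨l, hl, hlu⟩ := exists_mem_grid hM hu1
  set ξ' : Param p := θs + (1 / 4 : ℝ) • gridPoint (n * p) k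
  set u' : Param p := gridPoint (n * p) l
  -- Rounding a unit vector gives at most `2 + 4 p / (n p) ^ 2 ≤ 6`.
  have hu6 : ∑ j, u' j ^ 2 ≤ 6 := by
    refine (sum_sq_le_of_close hlu).trans ?_
    rw [hunorm, Nat.cast_mul, div_pow, one_pow, mul_one_div]
    have : 4 * (p : ℝ) / (n * p) ^ 2 ≤ 4 := by
      rw [div_le_iff₀ (by positivity)]
      nlinarith [mul_le_mul_of_nonneg_right hn' (by linarith : (0 : ℝ) ≤ p)]
    linarith
  have hgood : |totalScore ξ' u' (devA μ n X ω) (devB μ n X ω) (devD μ n X ω)| ≤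
      scoreLevel c n p := by
    by_contra hcon
    refine hω (Set.mem_biUnion (x := (k, l)) ?_ (le_of_lt (not_le.1 hcon)))
    rw [Finset.mem_coe, gridPairs, Finset.mem_filter, Finset.mem_product]
    exact ⟨⟨hk, hl⟩, hu6⟩
  have hξξ' (j) : |ξ j - ξ' j| ≤ 1 / ((n * p : ℕ) : ℝ) := by
    have h1 := hkξ j
    have h2 : ξ j - ξ' j = 1 / 4 * (((4 * x) • (θ - θs)) j - gridPoint (n * p) k j) := by
      simp only [ξ, ξ', PiLp.add_apply, PiLp.smul_apply, smul_eq_mul]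
      ring
    rw [h2, abs_mul, abs_of_pos (by norm_num : (0 : ℝ) < 1 / 4)]
    linarith [abs_nonneg (((4 * x) • (θ - θs)) j - gridPoint (n * p) k j)]
  have hlip := abs_totalScore_sub_le (h.abs_devA_le n ω) (h.abs_devB_le n ω) (h.abs_devD_le n ω)
    (Nat.cast_nonneg n) (by positivity) hξξ' hlu (abs_gridPoint_le hl)
  have hlip' : 28 * (1 / ((n * p : ℕ) : ℝ)) * n * (p : ℝ) ^ 2 = 28 * p := by
    push_cast
    field_simp
  rw [hlip'] at hlip
  set T := totalScore ξ u (devA μ n X ω) (devB μ n X ω) (devD μ n X ω)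
  have hT : |T| ≤ scoreLevel c n p + 28 * p := by
    have := abs_sub_abs_le_abs_sub T
      (totalScore ξ' u' (devA μ n X ω) (devB μ n X ω) (devD μ n X ω))
    linarith
  set r := Real.sqrt (Real.log ((n : ℝ) * p) / n) with hr
  have hfinal : 1 / ((n : ℝ) * p) * (scoreLevel c n p + 28 * p) ≤
      (Real.sqrt (9600 * (14 + c)) + 56) * rate n p := by
    have h1 : 1 / ((n : ℝ) * p) * (scoreLevel c n p + 28 * p) =
        Real.sqrt (9600 * (14 + c)) * r + 28 * (1 / n) := by
      rw [scoreLevel, ← hr]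
      field_simp
    have h2 := one_div_le_two_mul_sqrt hn hnp
    have h3 := sqrt_le_rate hn hp
    rw [h1]
    calc Real.sqrt (9600 * (14 + c)) * r + 28 * (1 / n)
        ≤ Real.sqrt (9600 * (14 + c)) * r + 28 * (2 * r) := by gcongr
      _ = (Real.sqrt (9600 * (14 + c)) + 56) * r := by ring
      _ ≤ (Real.sqrt (9600 * (14 + c)) + 56) * rate n p := by gcongr
  have hTu : totalScore ξ (θ - θs) (devA μ n X ω) (devB μ n X ω) (devD μ n X ω) = δ * T := by
    rw [← totalScore_smul, ← hθu]
  rw [hdiff, hmv, hTu, abs_mul, abs_neg, abs_mul, abs_of_pos hδpos,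
    abs_of_pos (by positivity : 0 < 1 / ((n : ℝ) * p))]
  calc 1 / ((n : ℝ) * p) * (δ * |T|) ≤
        1 / ((n : ℝ) * p) * (δ * (scoreLevel c n p + 28 * p)) := by gcongr
    _ = 1 / ((n : ℝ) * p) * (scoreLevel c n p + 28 * p) * δ := by ring
    _ ≤ (Real.sqrt (9600 * (14 + c)) + 56) * rate n p * δ := by gcongr

/-- The set of outcomes for which the deviation of the loss is uniformly controlled. -/
def goodEvent (μ : Measure Ω) (θs : Param p) (α C : ℝ) (n : ℕ)
    (X : ℕ → Ω → Matrix (Fin p) (Fin p) ℤ) : Set Ω :=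
  {ω | ∀ θ ∈ linftyBall θs α,
    |(randLoss n X θ ω - randLoss n X θs ω) - (expLoss μ n X θ - expLoss μ n X θs)|
      ≤ C * rate n p * ‖θ - θs‖}

theorem IsTWHM.lt_measure_goodEvent [IsProbabilityMeasure μ] (h : IsTWHM μ θs X)
    {c α : ℝ} (hc : 0 < c) (hα : α ≤ 1 / 4) {n : ℕ} (hn : 1 ≤ n) (hp : 1 ≤ p) :
    1 - ((n : ℝ) * p) ^ (-c) <
      μ.real (goodEvent μ θs α (Real.sqrt (9600 * (14 + c)) + 56) n X) := by
  obtain ⟨ε, h⟩ := h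
  -- For `p = 1` there are no edges and the loss is `0`; for `p ≥ 2` one has `n * p ≥ 2`, as the
  -- grid argument requires.
  rcases hp.eq_or_lt with rfl | hp2
  · have : IsEmpty (Edge 1) := ⟨fun e => by
      have h1 := e.2
      rw [Subsingleton.elim e.1.1 e.1.2] at h1
      exact lt_irrefl _ h1⟩
    have huniv : goodEvent μ θs α (Real.sqrt (9600 * (14 + c)) + 56) n X = Set.univ := by
      refine Set.eq_univ_of_forall fun ω θ _ => ?_
      have := rate_nonneg hn le_rfl
      simp only [expLoss, randLoss, loss, Finset.univ_eq_empty, Finset.sum_empty]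
      simp only [mul_zero, sub_zero, integral_zero, abs_zero]
      positivity
    have hn' : (0 : ℝ) < n := by exact_mod_cast hn
    rw [huniv, probReal_univ]
    linarith [Real.rpow_pos_of_pos (by simpa using hn' : (0 : ℝ) < n * (1 : ℕ)) (-c)]
  · have hnp : 2 ≤ n * p := by nlinarith
    have hbad := h.measure_badEvent_lt hc hn hp hnp
    -- `goodEvent` is an uncountable intersection; covering and subadditivity avoid any question of
    -- its measurability.
    have hcover : Set.univ ⊆ goodEvent μ θs α (Real.sqrt (9600 * (14 + c)) + 56) n X ∪
        badEvent μ θs c n X := fun ω _ => by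
      by_cases hω : ω ∈ badEvent μ θs c n X
      · exact Or.inr hω
      · exact Or.inl fun θ hθ => h.abs_loss_deviation_le hα hn hp hnp hω hθ
    have h1 := (measureReal_mono (μ := μ) hcover).trans (measureReal_union_le _ _)
    rw [probReal_univ] at h1
    linarith

theorem withNode_mem_linftyBall {α : ℝ} (hα : 0 ≤ α) {i : Fin p} {η : EuclideanSpace ℝ (Fin 2)}
    (hη : η ∈ linftyBall (nodeParam θs i) α) : withNode θs i η ∈ linftyBall θs α := by
  refine (pi_norm_le_iff_of_nonneg hα).2 fun k => ?_
  simp only [Pi.sub_apply, withNode]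
  split_ifs with hk
  · have h := abs_apply_sub_le_of_mem_linftyBall hη k.2
    simpa [nodeParam, ← hk] using h
  · simpa using hα

theorem norm_withNode_sub (θs : Param p) (i : Fin p) (η : EuclideanSpace ℝ (Fin 2)) :
    ‖withNode θs i η - θs‖ = ‖η - nodeParam θs i‖ := by
  rw [EuclideanSpace.norm_eq, EuclideanSpace.norm_eq, Fintype.sum_prod_type,
    Finset.sum_eq_single i]
  · simp [withNode, nodeParam]
  · intro j _ hj
    simp [withNode, hj]
  · simp

end Concentration

end TWHM

end

theorem corollary4 (α₀ K : ℝ) (hα₀ : 0 < α₀) (hα₀' : α₀ < 1 / 4) :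
    (∀ c₁ : ℝ, 0 < c₁ → ∃ C₁ : ℝ, 0 < C₁ ∧
      ∀ (n p : ℕ), 1 ≤ n → 1 ≤ p →
      ∀ (Ω : Type*) [MeasurableSpace Ω] (μ : Measure Ω) [IsProbabilityMeasure μ]
        (θs : TWHM.Param p) (X : ℕ → Ω → Matrix (Fin p) (Fin p) ℤ),
        (∀ i : Fin p, θs (i, 1) - max (θs (i, 0)) 0 < K) →
        TWHM.IsTWHM μ θs X →
        1 - ((n : ℝ) * p) ^ (-c₁) <
          μ.real {ω | ∀ θ ∈ TWHM.linftyBall θs α₀,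
            |(TWHM.randLoss n X θ ω - TWHM.randLoss n X θs ω)
                - (TWHM.expLoss μ n X θ - TWHM.expLoss μ n X θs)|
              ≤ C₁ * TWHM.rate n p * ‖θ - θs‖}) ∧
    (∀ c₂ : ℝ, 0 < c₂ → ∃ C₂ : ℝ, 0 < C₂ ∧
      ∀ (n p : ℕ), 1 ≤ n → 1 ≤ p →
      ∀ (Ω : Type*) [MeasurableSpace Ω] (μ : Measure Ω) [IsProbabilityMeasure μ]
        (θs : TWHM.Param p) (X : ℕ → Ω → Matrix (Fin p) (Fin p) ℤ),
        (∀ i : Fin p, θs (i, 1) - max (θs (i, 0)) 0 < K) →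
        TWHM.IsTWHM μ θs X →
        1 - ((n : ℝ) * p) ^ (-c₂) <
          μ.real {ω | ∀ i : Fin p,
            ∀ η ∈ TWHM.linftyBall (TWHM.nodeParam θs i) α₀,
            |(TWHM.randLoss n X (TWHM.withNode θs i η) ω - TWHM.randLoss n X θs ω)
                - (TWHM.expLoss μ n X (TWHM.withNode θs i η) - TWHM.expLoss μ n X θs)|
              ≤ C₂ * TWHM.rate n p * ‖η - TWHM.nodeParam θs i‖}) := by
  refine ⟨fun c hc => ⟨Real.sqrt (9600 * (14 + c)) + 56, by positivity, ?_⟩,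
    fun c hc => ⟨Real.sqrt (9600 * (14 + c)) + 56, by positivity, ?_⟩⟩
  · intro n p hn hp Ω _ μ _ θs X _ hX
    exact hX.lt_measure_goodEvent hc hα₀'.le hn hp
  · intro n p hn hp Ω _ μ _ θs X _ hX
    -- Changing one node stays in the global ball and preserves the Euclidean distance, so the same
    -- event serves all nodes at once, with no further union bound.
    refine (hX.lt_measure_goodEvent hc hα₀'.le hn hp).trans_le (measureReal_mono ?_)
    intro ω hω i η hη
    rw [← TWHM.norm_withNode_sub]
    exact hω _ (TWHM.withNode_mem_linftyBall hα₀.le hη)
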